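/- Let $d,n\in\mathbb{N}$ with $n\ge 2$, let $\beta\in(0,1]$, and let $I=[0,1]$. **Spaces.** For $0<\alpha\le 1$ let $C^{n,\alpha}_0=C^{n,\alpha}_0(\mathbb{R}^d,\mathbb{R}^d)$ be the space of all $C^n$-maps $f:\mathbb{R}^d\to\mathbb{R}^d$ that tend to $0$ at infinity together with all their derivatives of order $\le n$ and satisfy $$\|f\|_{n,\alpha}:=\max\Big\{\sup_{x,\,0\le l\le n}\|f^{(l)}(x)\|,\ \sup_{x\ne y}\frac{\|f^{(n)}(x)-f^{(n)}(y)\|}{\|x-y\|^{\alpha}}\Big\}<\infty .$$ Let $C^{n,\beta-}_0:=\bigcap_{0<\alpha<\beta}C^{n,\alpha}_0$ with the projective topology, i.e. the one given by the norms $\|\cdot\|_{n,\alpha}$, $0<\alpha<\beta$. Let $$\mathcal{D}^{n,\beta-}(\mathbb{R}^d):=\{\Phi\in\mathrm{Id}+C^{n,\beta-}_0 : \det d\Phi(x)>0\ \text{for all } x\in\mathbb{R}^d\},$$ with the topology for which $\Phi\mapsto\Phi-\mathrm{Id}$ is a homeomorphism onto its image in $C^{n,\beta-}_0$, and let $C(I,\mathcal{D}^{n,\beta-}(\mathbb{R}^d))$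 carry the compact-open topology. Let $L^1(I,C^{n,\beta-}_0)$ be the space of all (classes, modulo equality almost everywhere, of) functions $u:I\to C^{n,\beta-}_0$ that are Bochner integrable as functions $I\to C^{n,\alpha}_0$ for every $\alpha\in(0,\beta)$, with the topology given by the seminorms $\int_0^1\|u(t)\|_{n,\alpha}\,dt$, $0<\alpha<\beta$. **Flows.** A map $\Phi:I\times\mathbb{R}^d\to\mathbb{R}^d$ is a pointwise flow of $u$ if for every $x\in\mathbb{R}^d$ the function $s\mapsto u(s)(\Phi(s,x))$ is integrable on $I$ and $$\Phi(t,x)=x+\int_0^t u(s)(\Phi(s,x))\,ds\qquad\text{for all } t\in I .$$ **Regularity.** A slowly vanishing modulus of continuity is an increasing (i.e. non-decreasing) subadditive function $\omega:[0,\infty)\to[0,\infty)$ with $\lim_{t\to0}\omega(t)=\omega(0)=0$ and $\liminf_{t\downarrow0}\omega(t)/t^{\gamma}>0$ for all $\gamma>0$. A curve $c:\mathbb{R}\to F$ in a locally convex space $F$ is $C^{0,\omega}$ if for each bounded interval $J\subseteq\mathbb{R}$ the set $\{(c(t)-c(s))/\omega(|t-s|) : s,t\in J,\ s\ne t\}$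 is bounded in $F$. A map between locally convex spaces is $C^{0,\omega}$ if it maps $C^\infty$-curves to $C^{0,\omega}$-curves. **Theorem.** Every $u\in L^1(I,C^{n,\beta-}_0)$ has a unique pointwise flow $\Phi_u$; this flow does not depend on the representative of $u$, and $t\mapsto\Phi_u(t,\cdot)$ belongs to $C(I,\mathcal{D}^{n,\beta-}(\mathbb{R}^d))$. The flow map $$L^1(I,C^{n,\beta-}_0)\to C(I,\mathcal{D}^{n,\beta-}(\mathbb{R}^d)),\qquad u\mapsto\Phi_u,$$ is continuous. For every slowly vanishing modulus of continuity $\omega$ it is $C^{0,\omega}$ in the chart $\Phi\mapsto\Phi-\mathrm{Id}$, i.e. the map $L^1(I,C^{n,\beta-}_0)\to C(I,C^{n,\beta-}_0)$, $u\mapsto\Phi_u-\mathrm{Id}$, is $C^{0,\omega}$, where $C(I,C^{n,\beta-}_0)$ carries the compact-open topology. -/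

import Mathlib

open Set Filter Topology MeasureTheory
open scoped NNReal ENNReal unitInterval

noncomputable section

namespace HolderFlow

/-- Euclidean space `ℝ^d`. -/
abbrev Space (d : ℕ) : Type := EuclideanSpace ℝ (Fin d)

/-! ### The Hölder spaces `C^{n,α}_0(ℝ^d, ℝ^d)` -/

/-- `‖f‖_n = sup {‖f^{(l)}(x)‖ : x ∈ ℝ^d, 0 ≤ l ≤ n}`, with values in `[0, ∞]`. -/
def eCNorm (n : ℕ) {d : ℕ} (f : Space d → Space d) : ℝ≥0∞ :=
  ⨆ (l : ℕ) (_ : l ≤ n) (x : Space d), ‖iteratedFDeriv ℝ l f x‖ₑ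

/-- `[f]_{n,α} = sup_{x ≠ y} ‖f^{(n)}(x) - f^{(n)}(y)‖ / ‖x - y‖^α`, with values in `[0, ∞]`. -/
def eHolderSeminorm (n : ℕ) (α : ℝ) {d : ℕ} (f : Space d → Space d) : ℝ≥0∞ :=
  ⨆ (x : Space d) (y : Space d) (_ : x ≠ y),
    ‖iteratedFDeriv ℝ n f x - iteratedFDeriv ℝ n f y‖ₑ / ‖x - y‖ₑ ^ α

/-- `‖f‖_{n,α} = max {‖f‖_n, [f]_{n,α}}`, with values in `[0, ∞]`. -/
def eHolderNorm (n : ℕ) (α : ℝ) {d : ℕ} (f : Space d → Space d) : ℝ≥0∞ :=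
  max (eCNorm n f) (eHolderSeminorm n α f)

theorem enorm_le_eHolderNorm {n : ℕ} (α : ℝ) {d : ℕ} (f : Space d → Space d) {l : ℕ} (hl : l ≤ n)
    (x : Space d) : ‖iteratedFDeriv ℝ l f x‖ₑ ≤ eHolderNorm n α f := by
  refine le_trans ?_ (le_max_left _ _)
  unfold eCNorm
  exact le_iSup_of_le l (le_iSup_of_le hl (le_iSup (fun x => ‖iteratedFDeriv ℝ l f x‖ₑ) x))

theorem quotient_le_eHolderNorm (n : ℕ) (α : ℝ) {d : ℕ} (f : Space d → Space d) {x y : Space d}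
    (hxy : x ≠ y) :
    ‖iteratedFDeriv ℝ n f x - iteratedFDeriv ℝ n f y‖ₑ / ‖x - y‖ₑ ^ α ≤ eHolderNorm n α f := by
  refine le_trans ?_ (le_max_right _ _)
  unfold eHolderSeminorm
  exact le_iSup_of_le x (le_iSup_of_le y (le_iSup_of_le (f := fun _ : x ≠ y => _) hxy le_rfl))

theorem eHolderNorm_zero (n : ℕ) (α : ℝ) {d : ℕ} :
    eHolderNorm n α (0 : Space d → Space d) = 0 := by
  have h : ∀ (l : ℕ) (x : Space d), iteratedFDeriv ℝ l (0 : Space d → Space d) x = 0 := by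
    intro l x
    have := congrFun (iteratedFDeriv_fun_zero (𝕜 := ℝ) (E := Space d) (F := Space d) (n := l)) x
    exact this
  simp [eHolderNorm, eCNorm, eHolderSeminorm, h]

theorem eHolderNorm_add_le (n : ℕ) (α : ℝ) {d : ℕ} {f g : Space d → Space d}
    (hf : ContDiff ℝ n f) (hg : ContDiff ℝ n g) :
    eHolderNorm n α (f + g) ≤ eHolderNorm n α f + eHolderNorm n α g := by
  have h : ∀ l ≤ n, ∀ x, iteratedFDeriv ℝ l (f + g) x
      = iteratedFDeriv ℝ l f x + iteratedFDeriv ℝ l g x := fun l hl x =>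
    iteratedFDeriv_add_apply ((hf.of_le (by exact_mod_cast hl)).contDiffAt)
      ((hg.of_le (by exact_mod_cast hl)).contDiffAt)
  refine max_le ?_ ?_
  · refine iSup_le fun l => iSup_le fun hl => iSup_le fun x => ?_
    rw [h l hl x]
    refine (enorm_add_le _ _).trans (add_le_add ?_ ?_)
    · exact enorm_le_eHolderNorm α f hl x
    · exact enorm_le_eHolderNorm α g hl x
  · refine iSup_le fun x => iSup_le fun y => iSup_le fun hxy => ?_
    rw [h n le_rfl x, h n le_rfl y, add_sub_add_comm]
    refine (ENNReal.div_le_div_right (enorm_add_le _ _) _).trans ?_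
    rw [ENNReal.add_div]
    refine add_le_add ?_ ?_
    · exact quotient_le_eHolderNorm n α f hxy
    · exact quotient_le_eHolderNorm n α g hxy

theorem eHolderNorm_smul (n : ℕ) (α : ℝ) {d : ℕ} (c : ℝ) {f : Space d → Space d}
    (hf : ContDiff ℝ n f) :
    eHolderNorm n α (c • f) = ‖c‖ₑ * eHolderNorm n α f := by
  have h : ∀ l ≤ n, ∀ x, iteratedFDeriv ℝ l (c • f) x
      = c • iteratedFDeriv ℝ l f x := fun l hl x =>
    iteratedFDeriv_const_smul_apply ((hf.of_le (by exact_mod_cast hl)).contDiffAt)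
  have h1 : eCNorm n (c • f) = ‖c‖ₑ * eCNorm n f := by
    simp only [eCNorm, ENNReal.mul_iSup]
    refine iSup_congr fun l => iSup_congr fun hl => iSup_congr fun x => ?_
    rw [h l hl x, enorm_smul]
  have h2 : eHolderSeminorm n α (c • f) = ‖c‖ₑ * eHolderSeminorm n α f := by
    simp only [eHolderSeminorm, ENNReal.mul_iSup]
    refine iSup_congr fun x => iSup_congr fun y => iSup_congr fun hxy => ?_
    rw [h n le_rfl x, h n le_rfl y, ← smul_sub, enorm_smul, mul_div_assoc]
  rw [eHolderNorm, h1, h2, eHolderNorm, mul_max]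

/-- The linear space of the `C^n` maps `f : ℝ^d → ℝ^d` with `‖f‖_{n,α} < ∞` that tend to `0` at
infinity together with all their derivatives up to order `n`. -/
def c0HolderSubmodule (n : ℕ) (α : ℝ) (d : ℕ) : Submodule ℝ (Space d → Space d) where
  carrier := {f | ContDiff ℝ n f ∧ eHolderNorm n α f < ∞ ∧
    ∀ l ≤ n, Tendsto (iteratedFDeriv ℝ l f) (Bornology.cobounded (Space d)) (𝓝 0)}
  zero_mem' := by
    refine ⟨contDiff_const, by rw [eHolderNorm_zero]; exact ENNReal.zero_lt_top, fun l _ => ?_⟩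
    have : iteratedFDeriv ℝ l (0 : Space d → Space d) = 0 :=
      iteratedFDeriv_fun_zero
    rw [this]
    exact tendsto_const_nhds
  add_mem' := by
    rintro f g ⟨hf, hf', hf''⟩ ⟨hg, hg', hg''⟩
    refine ⟨hf.add hg, (eHolderNorm_add_le n α hf hg).trans_lt (ENNReal.add_lt_top.2 ⟨hf', hg'⟩),
      fun l hl => ?_⟩
    have h : iteratedFDeriv ℝ l (f + g) = iteratedFDeriv ℝ l f + iteratedFDeriv ℝ l g :=
      funext fun x => iteratedFDeriv_add_apply ((hf.of_le (by exact_mod_cast hl)).contDiffAt)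
        ((hg.of_le (by exact_mod_cast hl)).contDiffAt)
    rw [h, ← add_zero (0 : Space d [×l]→L[ℝ] Space d)]
    exact (hf'' l hl).add (hg'' l hl)
  smul_mem' := by
    rintro c f ⟨hf, hf', hf''⟩
    refine ⟨hf.const_smul c, ?_, fun l hl => ?_⟩
    · rw [eHolderNorm_smul n α c hf]
      exact ENNReal.mul_lt_top enorm_lt_top hf'
    · have h : iteratedFDeriv ℝ l (c • f) = c • iteratedFDeriv ℝ l f :=
        funext fun x => iteratedFDeriv_const_smul_apply
          ((hf.of_le (by exact_mod_cast hl)).contDiffAt)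
      rw [h, ← smul_zero c]
      exact (hf'' l hl).const_smul c

/-- The Hölder space `C^{n,α}_0(ℝ^d, ℝ^d)`. -/
def C0Holder (n : ℕ) (α : ℝ) (d : ℕ) : Type := ↥(c0HolderSubmodule n α d)

namespace C0Holder

variable {n : ℕ} {α : ℝ} {d : ℕ}

instance : AddCommGroup (C0Holder n α d) := inferInstanceAs (AddCommGroup (c0HolderSubmodule n α d))

instance : Module ℝ (C0Holder n α d) := inferInstanceAs (Module ℝ (c0HolderSubmodule n α d))

instance : CoeFun (C0Holder n α d) (fun _ => Space d → Space d) := ⟨fun f => f.1⟩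

/-- The norm of `C^{n,α}_0(ℝ^d, ℝ^d)` is `‖f‖_{n,α}` (a finite number on this space). -/
instance : Norm (C0Holder n α d) := ⟨fun f => (eHolderNorm n α f.1).toReal⟩

theorem norm_def (f : C0Holder n α d) : ‖f‖ = (eHolderNorm n α f.1).toReal := rfl

theorem normCore : NormedSpace.Core ℝ (C0Holder n α d) where
  norm_nonneg _ := ENNReal.toReal_nonneg
  norm_smul c f := by
    rw [norm_def, norm_def]
    change (eHolderNorm n α (c • f.1)).toReal = _
    rw [eHolderNorm_smul n α c f.2.1, ENNReal.toReal_mul, toReal_enorm]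
  norm_triangle f g := by
    rw [norm_def, norm_def, norm_def]
    change (eHolderNorm n α (f.1 + g.1)).toReal ≤ _
    rw [← ENNReal.toReal_add f.2.2.1.ne g.2.2.1.ne]
    exact ENNReal.toReal_mono (ENNReal.add_lt_top.2 ⟨f.2.2.1, g.2.2.1⟩).ne
      (eHolderNorm_add_le n α f.2.1 g.2.1)
  norm_eq_zero_iff f := by
    constructor
    · intro hf
      rw [norm_def, ENNReal.toReal_eq_zero_iff, or_iff_left f.2.2.1.ne] at hf
      refine Subtype.ext (funext fun x => ?_)
      have h0 : ‖iteratedFDeriv ℝ 0 f.1 x‖ₑ ≤ eHolderNorm n α f.1 :=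
        enorm_le_eHolderNorm α f.1 (Nat.zero_le n) x
      rw [hf, nonpos_iff_eq_zero, enorm_eq_zero, ← norm_eq_zero, norm_iteratedFDeriv_zero,
        norm_eq_zero] at h0
      exact h0
    · rintro rfl
      rw [norm_def]
      change (eHolderNorm n α (0 : Space d → Space d)).toReal = 0
      rw [eHolderNorm_zero, ENNReal.toReal_zero]

instance : NormedAddCommGroup (C0Holder n α d) := NormedAddCommGroup.ofCore normCore

instance : NormedSpace ℝ (C0Holder n α d) := NormedSpace.ofCore normCore

end C0Holder

/-! ### The intermediate spaces `C^{n,β-}_0(ℝ^d, ℝ^d)` -/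

/-- The linear space `⋂_{α ∈ (0,β)} C^{n,α}_0(ℝ^d, ℝ^d)`. -/
def c0HolderMinusSubmodule (n : ℕ) (β : ℝ) (d : ℕ) : Submodule ℝ (Space d → Space d) :=
  ⨅ α : Ioo (0 : ℝ) β, c0HolderSubmodule n α d

/-- The space `C^{n,β-}_0(ℝ^d, ℝ^d)`. -/
def C0HolderMinus (n : ℕ) (β : ℝ) (d : ℕ) : Type := ↥(c0HolderMinusSubmodule n β d)

namespace C0HolderMinus

variable {n : ℕ} {β : ℝ} {d : ℕ}

instance : AddCommGroup (C0HolderMinus n β d) :=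
  inferInstanceAs (AddCommGroup (c0HolderMinusSubmodule n β d))

instance : Module ℝ (C0HolderMinus n β d) :=
  inferInstanceAs (Module ℝ (c0HolderMinusSubmodule n β d))

instance : CoeFun (C0HolderMinus n β d) (fun _ => Space d → Space d) := ⟨fun f => f.1⟩

/-- The inclusion `C^{n,β-}_0 → C^{n,α}_0` for `0 < α < β`. -/
def incl (α : Ioo (0 : ℝ) β) : C0HolderMinus n β d →ₗ[ℝ] C0Holder n α d where
  toFun f := ⟨f.1, (Submodule.mem_iInf _).1 f.2 α⟩
  map_add' _ _ := rfl
  map_smul' _ _ := rfl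

/-- The projective locally convex topology: the coarsest one that makes all the inclusions
`C^{n,β-}_0 → C^{n,α}_0`, `0 < α < β`, continuous. -/
instance : TopologicalSpace (C0HolderMinus n β d) :=
  ⨅ α : Ioo (0 : ℝ) β, TopologicalSpace.induced (incl α) inferInstance

instance : IsTopologicalAddGroup (C0HolderMinus n β d) :=
  topologicalAddGroup_iInf fun α => topologicalAddGroup_induced (incl α)

instance : ContinuousSMul ℝ (C0HolderMinus n β d) :=
  continuousSMul_iInf fun α => continuousSMul_induced (incl α)

end C0HolderMinus

/-! ### The groups `D^{n,β-}(ℝ^d)` -/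

/-- `D^{n,β-}(ℝ^d)`: the maps `Φ ∈ Id + C^{n,β-}_0(ℝ^d, ℝ^d)` with `det dΦ(x) > 0` for all `x`. -/
structure DiffMinus (n : ℕ) (β : ℝ) (d : ℕ) where
  /-- the underlying map -/
  toFun : Space d → Space d
  sub_id_mem : toFun - id ∈ c0HolderMinusSubmodule n β d
  det_pos : ∀ x, 0 < (fderiv ℝ toFun x).det

namespace DiffMinus

variable {n : ℕ} {β : ℝ} {d : ℕ}

instance : CoeFun (DiffMinus n β d) (fun _ => Space d → Space d) := ⟨DiffMinus.toFun⟩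

/-- The global chart `Φ ↦ Φ - Id`. -/
def chart (Φ : DiffMinus n β d) : C0HolderMinus n β d := ⟨Φ.toFun - id, Φ.sub_id_mem⟩

/-- A set `V` is open in `D^{n,β-}` if and only if `V - Id` is open in `D^{n,β-} - Id`, regarded as
a subspace of `C^{n,β-}_0`. -/
instance : TopologicalSpace (DiffMinus n β d) := TopologicalSpace.induced chart inferInstance

/-- The chart as a continuous map. -/
def chartMap : C(DiffMinus n β d, C0HolderMinus n β d) := ⟨chart, continuous_induced_dom⟩

end DiffMinus

/-! ### Strong time-dependent vector fields, `I = [0,1]` -/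

/-- The functions `u : I → C^{n,β-}_0(ℝ^d, ℝ^d)` that are Bochner integrable as functions
`I → C^{n,α}_0(ℝ^d, ℝ^d)` for all `α ∈ (0,β)`. -/
def strongFields (n : ℕ) (β : ℝ) (d : ℕ) : Submodule ℝ (I → C0HolderMinus n β d) where
  carrier := {u | ∀ α : Ioo (0 : ℝ) β,
    Integrable (fun t => C0HolderMinus.incl α (u t)) (volume : Measure I)}
  zero_mem' α := by
    simp only [Pi.zero_apply, map_zero]
    exact integrable_zero _ _ _
  add_mem' {u v} hu hv α := by
    simp only [Pi.add_apply, map_add]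
    exact (hu α).add (hv α)
  smul_mem' c u hu α := by
    simp only [Pi.smul_apply, map_smul]
    exact (hu α).smul c

/-- The elements of `strongFields` that vanish almost everywhere. -/
def nullFields (n : ℕ) (β : ℝ) (d : ℕ) : Submodule ℝ (strongFields n β d) where
  carrier := {u | ∀ᵐ t ∂(volume : Measure I), u.1 t = 0}
  zero_mem' := by
    change ∀ᵐ t ∂(volume : Measure I), (0 : C0HolderMinus n β d) = 0
    exact Eventually.of_forall fun _ => rfl
  add_mem' {u v} hu hv := by
    change ∀ᵐ t ∂(volume : Measure I), u.1 t + v.1 t = 0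
    filter_upwards [hu, hv] with t h1 h2
    rw [h1, h2, add_zero]
  smul_mem' c u hu := by
    change ∀ᵐ t ∂(volume : Measure I), c • u.1 t = 0
    filter_upwards [hu] with t h1
    rw [h1, smul_zero]

/-- The space `L^1(I, C^{n,β-}_0(ℝ^d, ℝ^d))` of classes, with respect to equality almost
everywhere, of strong time-dependent `C^{n,β-}_0`-vector fields. -/
def L1Minus (n : ℕ) (β : ℝ) (d : ℕ) : Type := ↥(strongFields n β d) ⧸ nullFields n β d

namespace L1Minus

variable {n : ℕ} {β : ℝ} {d : ℕ}

instance : AddCommGroup (L1Minus n β d) :=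
  inferInstanceAs (AddCommGroup (↥(strongFields n β d) ⧸ nullFields n β d))

instance : Module ℝ (L1Minus n β d) :=
  inferInstanceAs (Module ℝ (↥(strongFields n β d) ⧸ nullFields n β d))

/-- The class of a vector field. -/
def mk : strongFields n β d →ₗ[ℝ] L1Minus n β d := (nullFields n β d).mkQ

/-- A strong time-dependent `C^{n,β-}_0`-vector field as an element of the Banach space
`L^1(I, C^{n,α}_0)`, for `0 < α < β`. -/
def fieldToL1 (α : Ioo (0 : ℝ) β) :
    strongFields n β d →ₗ[ℝ] Lp (C0Holder n α d) 1 (volume : Measure I) where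
  toFun u := (u.2 α).toL1 _
  map_add' u v := Integrable.toL1_add _ _ (u.2 α) (v.2 α)
  map_smul' c u := Integrable.toL1_smul _ (u.2 α) c

theorem nullFields_le_ker (α : Ioo (0 : ℝ) β) :
    nullFields n β d ≤ LinearMap.ker (fieldToL1 (n := n) (d := d) α) := by
  intro u hu
  have hu' : ∀ᵐ t ∂(volume : Measure I), u.1 t = 0 := hu
  have h : fieldToL1 α u = fieldToL1 α 0 := by
    refine (Integrable.toL1_eq_toL1_iff _ _ (u.2 α) ((0 : strongFields n β d).2 α)).2 ?_
    filter_upwards [hu'] with t ht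
    rw [ht]
    rfl
  rw [LinearMap.mem_ker, h, map_zero]

/-- The canonical map `L^1(I, C^{n,β-}_0) → L^1(I, C^{n,α}_0)` for `0 < α < β`. -/
def toL1 (α : Ioo (0 : ℝ) β) :
    L1Minus n β d →ₗ[ℝ] Lp (C0Holder n α d) 1 (volume : Measure I) :=
  (nullFields n β d).liftQ (fieldToL1 α) (nullFields_le_ker α)

/-- The locally convex topology given by the seminorms
`‖u‖_{L^1(I,C^{n,α})} = ∫ t in I, ‖u(t)‖_{n,α}`, `0 < α < β`. -/
instance : TopologicalSpace (L1Minus n β d) :=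
  ⨅ α : Ioo (0 : ℝ) β, TopologicalSpace.induced (toL1 α) inferInstance

end L1Minus

/-! ### Flows -/

/-- `Φ` is the pointwise flow of `u`: for all `x`, the function `s ↦ u(s, Φ(s,x))` is integrable
on `I` and `Φ(t,x) = x + ∫ s in 0..t, u(s, Φ(s,x))` for all `t ∈ I`. -/
def IsPointwiseFlow {n : ℕ} {β : ℝ} {d : ℕ} (u : I → C0HolderMinus n β d)
    (Φ : I → Space d → Space d) : Prop :=
  ∀ x : Space d, Integrable (fun s : I => u s (Φ s x)) volume ∧
    ∀ t : I, Φ t x = x + ∫ s in Iic t, u s (Φ s x)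

/-! ### `C^{0,ω}`-maps -/

/-- `ω : [0,∞) → [0,∞)` is a slowly vanishing modulus of continuity. The limes inferior is taken
in `[0,∞]`. -/
structure IsSlowlyVanishing (ω : ℝ≥0 → ℝ≥0) : Prop where
  map_zero : ω 0 = 0
  tendsto_zero : Tendsto ω (𝓝 0) (𝓝 0)
  monotone : Monotone ω
  subadditive : ∀ s t, ω (s + t) ≤ ω s + ω t
  liminf_pos : ∀ γ : ℝ, 0 < γ →
    0 < liminf (fun t : ℝ≥0 => (ω t : ℝ≥0∞) / (t : ℝ≥0∞) ^ γ) (𝓝[>] 0)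

section Curves

variable {E F : Type*} [AddCommGroup E] [Module ℝ E] [TopologicalSpace E]
  [AddCommGroup F] [Module ℝ F] [TopologicalSpace F]

/-- `c : ℝ → E` is a `C^∞`-curve in the topological vector space `E`: its derivatives `c^{(k)}` of
all orders exist, as limits of difference quotients in `E`. -/
def IsSmoothCurve (c : ℝ → E) : Prop :=
  ∃ D : ℕ → ℝ → E, D 0 = c ∧ ∀ (k : ℕ) (t : ℝ),
    Tendsto (fun h : ℝ => h⁻¹ • (D k (t + h) - D k t)) (𝓝[≠] 0) (𝓝 (D (k + 1) t))

/-- `c : ℝ → F` is a `C^{0,ω}`-curve: the quotients `(c(t) - c(s)) / ω(|t - s|)` with `s ≠ t` in a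
bounded interval form a bounded set in the topological vector space `F`. -/
def IsC0OmegaCurve (ω : ℝ≥0 → ℝ≥0) (c : ℝ → F) : Prop :=
  ∀ a b : ℝ, Bornology.IsVonNBounded ℝ
    {v : F | ∃ s ∈ Icc a b, ∃ t ∈ Icc a b, t ≠ s ∧
      v = ((ω (nndist t s) : ℝ≥0) : ℝ)⁻¹ • (c t - c s)}

/-- A map is `C^{0,ω}` if it maps `C^∞`-curves to `C^{0,ω}`-curves. -/
def IsC0OmegaMap (ω : ℝ≥0 → ℝ≥0) (f : E → F) : Prop :=
  ∀ c : ℝ → E, IsSmoothCurve c → IsC0OmegaCurve ω (f ∘ c)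

end Curves

end HolderFlow

end

/-! Only sup-norm estimates are made for the differential equation itself; everything about
derivatives comes from uniform Hölder bounds and interpolation.

For a field `u` integrable into `C^{n,α}_0`, replace the flow up to time `t` by the Euler product
`(id + f_{N-1}) ∘ ⋯ ∘ (id + f_0)`, where `f_j` is the integral of `u` over the `j`-th of `N` equal
time steps. Each step enlarges the `C^{n,α}` bound by a factor `1 + C‖f_j‖`, so these products are
bounded in `Id + C^{n,α}` by a constant that depends only on `∫‖u‖`, not on `N`
(`exists_holderBound_eulerMap`). A discrete Gronwall argument shows that they converge uniformly to
every pointwise flow (`IsFlow.tendstoUniformly_eulerApprox`). This gives uniqueness, and since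
Hölder bounds survive uniform limits (`HolderBound.of_tendstoUniformly`) the flow inherits the
bound. Existence is a weighted contraction argument (`exists_integral_curve`).

The same Gronwall argument gives a `C^0`-Lipschitz estimate in `u` (`IsFlow.norm_sub_flow_le`).
Interpolating it with the `C^{n,α'}` bound for some `α' ∈ (α, β)` shows that on bounded sets `u ↦
Φ_u` is Hölder of some exponent `γ > 0` into `C^{n,α}`, uniformly in `t`
(`exists_norm_flow_sub_le`). The loss from `α'` to `α` is harmless because all exponents below `β`
are available. A smooth curve of fields is locally Lipschitz, so its image is locally `γ`-Hölder,
and a slowly vanishing `ω` dominates every power `r^γ` on bounded intervals, up to a constant.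

The determinant is positive because the flow has a lower Lipschitz bound: it never vanishes, depends
continuously on `t`, and equals `1` at `t = 0`. -/

namespace HolderFlow

universe w

/-! ### Hölder bounds for sums, products and compositions. -/

section HolderBound

variable {E F G H : Type w} [NormedAddCommGroup E] [NormedSpace ℝ E]
  [NormedAddCommGroup F] [NormedSpace ℝ F] [NormedAddCommGroup G] [NormedSpace ℝ G]
  [NormedAddCommGroup H] [NormedSpace ℝ H]

/-- `f` is of class `C^n`, its derivatives up to order `n` are bounded by `M`, and its `n`-th
derivative is `α`-Hölder with constant `M`. -/
def HolderBound (n : ℕ) (α M : ℝ) (f : E → F) : Prop :=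
  ContDiff ℝ n f ∧ (∀ l ≤ n, ∀ x, ‖iteratedFDeriv ℝ l f x‖ ≤ M) ∧
    ∀ x y, ‖iteratedFDeriv ℝ n f x - iteratedFDeriv ℝ n f y‖ ≤ M * ‖x - y‖ ^ α

namespace HolderBound

variable {n : ℕ} {α M N : ℝ} {f g : E → F}

theorem norm_le (hf : HolderBound n α M f) (x : E) : ‖f x‖ ≤ M := by
  simpa using hf.2.1 0 (Nat.zero_le n) x

theorem nonneg (hf : HolderBound n α M f) : 0 ≤ M := (norm_nonneg _).trans (hf.norm_le 0)

theorem mono (hf : HolderBound n α M f) (h : M ≤ N) : HolderBound n α N f :=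
  ⟨hf.1, fun l hl x => (hf.2.1 l hl x).trans h, fun x y => (hf.2.2 x y).trans (by gcongr)⟩

theorem zero_iff : HolderBound 0 α M f ↔
    (∀ x, ‖f x‖ ≤ M) ∧ Continuous f ∧ ∀ x y, ‖f x - f y‖ ≤ M * ‖x - y‖ ^ α := by
  have key : ∀ x y, ‖iteratedFDeriv ℝ 0 f x - iteratedFDeriv ℝ 0 f y‖ = ‖f x - f y‖ := by
    intro x y
    rw [iteratedFDeriv_zero_eq_comp, Function.comp_apply, Function.comp_apply, ← map_sub,
      LinearIsometryEquiv.norm_map]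
  simp only [HolderBound, key, Nat.le_zero, forall_eq, norm_iteratedFDeriv_zero, CharP.cast_eq_zero,
    contDiff_zero]
  tauto

/-- The engine of all inductions on `n`: differentiating lowers the order and only changes the
target to `E →L[ℝ] F`. This is why all spaces share one universe and the target is generalized in
the inductions. -/
theorem succ_iff : HolderBound (n + 1) α M f ↔
    (∀ x, ‖f x‖ ≤ M) ∧ Differentiable ℝ f ∧ HolderBound n α M (fderiv ℝ f) := by
  have key : ∀ x y, ‖iteratedFDeriv ℝ (n + 1) f x - iteratedFDeriv ℝ (n + 1) f y‖
      = ‖iteratedFDeriv ℝ n (fderiv ℝ f) x - iteratedFDeriv ℝ n (fderiv ℝ f) y‖ := by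
    intro x y
    rw [iteratedFDeriv_succ_eq_comp_right, iteratedFDeriv_succ_eq_comp_right, Function.comp_apply,
      Function.comp_apply, ← dist_eq_norm, ← dist_eq_norm, LinearIsometryEquiv.dist_map]
  simp only [HolderBound, key, norm_iteratedFDeriv_fderiv, Nat.cast_add, Nat.cast_one,
    contDiff_succ_iff_fderiv]
  constructor
  · rintro ⟨⟨h1, -, h2⟩, h3, h4⟩
    exact ⟨fun x => by simpa using h3 0 (Nat.zero_le _) x, h1, h2,
      fun l hl x => h3 (l + 1) (by omega) x, h4⟩
  · rintro ⟨h0, h1, h2, h3, h4⟩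
    refine ⟨⟨h1, by simp, h2⟩, fun l hl x => ?_, h4⟩
    cases l with
    | zero => simpa using h0 x
    | succ l => exact h3 l (by omega) x

theorem differentiable (hf : HolderBound (n + 1) α M f) : Differentiable ℝ f := (succ_iff.1 hf).2.1

theorem fderiv (hf : HolderBound (n + 1) α M f) : HolderBound n α M (fderiv ℝ f) :=
  (succ_iff.1 hf).2.2

theorem norm_sub_le (hf : HolderBound (n + 1) α M f) (x y : E) : ‖f x - f y‖ ≤ M * ‖x - y‖ :=
  Convex.norm_image_sub_le_of_norm_fderiv_le (s := univ) (fun z _ => hf.differentiable z)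
    (fun z _ => hf.fderiv.norm_le z) convex_univ (mem_univ y) (mem_univ x)

/-- Bounded Lipschitz maps are Hölder. -/
theorem zero_of_lipschitz (hα : α ∈ Ioc (0 : ℝ) 1) {K : ℝ} (h0 : ∀ x, ‖f x‖ ≤ M)
    (hK : ∀ x y, ‖f x - f y‖ ≤ K * ‖x - y‖) (hMN : 2 * M ≤ N) (hKN : K ≤ N) :
    HolderBound 0 α N f := by
  have hM : 0 ≤ M := (norm_nonneg _).trans (h0 0)
  have hc : Continuous f := by
    refine (LipschitzWith.of_dist_le_mul (K := Real.toNNReal N) fun x y => ?_).continuous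
    rw [dist_eq_norm, dist_eq_norm, Real.coe_toNNReal N (by linarith)]
    exact (hK x y).trans (by gcongr)
  refine zero_iff.2 ⟨fun x => (h0 x).trans (by linarith), hc, fun x y => ?_⟩
  -- At distance at most `1` the Lipschitz bound is the stronger one, since `r ≤ r ^ α`; beyond that
  -- the oscillation `2 * M` suffices.
  rcases le_total ‖x - y‖ 1 with h | h
  · refine (hK x y).trans ?_
    have h1 : ‖x - y‖ ≤ ‖x - y‖ ^ α := by
      rcases (norm_nonneg (x - y)).eq_or_lt with h2 | h2
      · rw [← h2, Real.zero_rpow hα.1.ne']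
      · simpa using Real.rpow_le_rpow_of_exponent_ge h2 h hα.2
    calc K * ‖x - y‖ ≤ N * ‖x - y‖ := by gcongr
      _ ≤ N * ‖x - y‖ ^ α := by gcongr; linarith
  · have h1 : 1 ≤ ‖x - y‖ ^ α := Real.one_le_rpow h hα.1.le
    calc ‖f x - f y‖ ≤ ‖f x‖ + ‖f y‖ := _root_.norm_sub_le _ _
      _ ≤ 2 * M := by linarith [h0 x, h0 y]
      _ ≤ N * 1 := by linarith
      _ ≤ N * ‖x - y‖ ^ α := by gcongr; linarith

/-- Only the Hölder condition on the `n`-th derivative is new, and that derivative is bounded and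
Lipschitz. The factor `2` comes from points at distance at least `1`. -/
theorem of_succ (hα : α ∈ Ioc (0 : ℝ) 1) (hf : HolderBound (n + 1) α M f) :
    HolderBound n α (2 * M) f := by
  induction n generalizing F with
  | zero =>
    have := hf.nonneg
    exact zero_of_lipschitz hα hf.norm_le hf.norm_sub_le le_rfl (by linarith)
  | succ n ih =>
    have := hf.nonneg
    exact succ_iff.2 ⟨fun x => (hf.norm_le x).trans (by linarith), hf.differentiable, ih hf.fderiv⟩

theorem add (hf : HolderBound n α M f) (hg : HolderBound n α N g) :
    HolderBound n α (M + N) (fun x => f x + g x) := by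
  have h : ∀ l ≤ n, ∀ x, iteratedFDeriv ℝ l (fun x => f x + g x) x
      = iteratedFDeriv ℝ l f x + iteratedFDeriv ℝ l g x := fun l hl x =>
    iteratedFDeriv_add_apply ((hf.1.of_le (by exact_mod_cast hl)).contDiffAt)
      ((hg.1.of_le (by exact_mod_cast hl)).contDiffAt)
  refine ⟨hf.1.add hg.1, fun l hl x => ?_, fun x y => ?_⟩
  · rw [h l hl]
    exact (norm_add_le _ _).trans (add_le_add (hf.2.1 l hl x) (hg.2.1 l hl x))
  · rw [h n le_rfl, h n le_rfl, add_sub_add_comm, add_mul]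
    exact (norm_add_le _ _).trans (add_le_add (hf.2.2 x y) (hg.2.2 x y))

theorem neg (hf : HolderBound n α M f) : HolderBound n α M (fun x => -f x) := by
  have h : ∀ l x, iteratedFDeriv ℝ l (fun x => -f x) x = -iteratedFDeriv ℝ l f x := fun l x =>
    iteratedFDeriv_neg_apply
  refine ⟨hf.1.neg, fun l hl x => ?_, fun x y => ?_⟩
  · rw [h, norm_neg]
    exact hf.2.1 l hl x
  · rw [h, h, ← neg_sub', norm_neg]
    exact hf.2.2 x y

theorem sub (hf : HolderBound n α M f) (hg : HolderBound n α N g) :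
    HolderBound n α (M + N) (fun x => f x - g x) := by
  simpa only [sub_eq_add_neg] using hf.add hg.neg

theorem const {c : F} (hc : ‖c‖ ≤ M) : HolderBound n α M (fun _ : E => c) := by
  have hM : 0 ≤ M := (norm_nonneg _).trans hc
  induction n generalizing F with
  | zero =>
    refine zero_iff.2 ⟨fun _ => hc, continuous_const, fun x y => ?_⟩
    rw [sub_self, norm_zero]
    positivity
  | succ n ih =>
    refine succ_iff.2 ⟨fun _ => hc, differentiable_const c, ?_⟩
    rw [fderiv_fun_const]
    exact ih (c := 0) (by simpa using hM)

/-- Bounds for products. -/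
theorem bilin (hα : α ∈ Ioc (0 : ℝ) 1) (L : F →L[ℝ] G →L[ℝ] H) (hL : ‖L‖ ≤ 1) {g : E → G}
    (hf : HolderBound n α M f) (hg : HolderBound n α N g) :
    HolderBound n α (2 * 4 ^ n * (M * N)) (fun x => L (f x) (g x)) := by
  have hM := hf.nonneg
  have hN := hg.nonneg
  have key : ∀ (a : F) (b : G), ‖L a b‖ ≤ ‖a‖ * ‖b‖ := fun a b =>
    (L.le_opNorm₂ a b).trans (by
      calc ‖L‖ * ‖a‖ * ‖b‖ ≤ 1 * ‖a‖ * ‖b‖ := by gcongr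
        _ = ‖a‖ * ‖b‖ := by ring)
  induction n generalizing F G H M N with
  | zero =>
    have h0 : ∀ x, ‖L (f x) (g x)‖ ≤ M * N := fun x => (key _ _).trans (by
      gcongr
      exacts [hf.norm_le x, hg.norm_le x])
    have hMN : 0 ≤ M * N := by positivity
    obtain ⟨-, hfc, hf2⟩ := zero_iff.1 hf
    obtain ⟨-, hgc, hg2⟩ := zero_iff.1 hg
    refine zero_iff.2 ⟨fun x => (h0 x).trans (by linarith), by fun_prop, fun x y => ?_⟩
    have h1 : L (f x) (g x) - L (f y) (g y) = L (f x - f y) (g x) + L (f y) (g x - g y) := by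
      simp
    rw [h1]
    calc ‖L (f x - f y) (g x) + L (f y) (g x - g y)‖
        ≤ ‖f x - f y‖ * ‖g x‖ + ‖f y‖ * ‖g x - g y‖ :=
          (norm_add_le _ _).trans (add_le_add (key _ _) (key _ _))
      _ ≤ (M * ‖x - y‖ ^ α) * N + M * (N * ‖x - y‖ ^ α) := by
          gcongr
          exacts [hf2 x y, hg.norm_le x, hf.norm_le y, hg2 x y]
      _ = _ := by ring
  | succ n ih =>
    have hMN : 0 ≤ M * N := by positivity
    have h4 : (1 : ℝ) ≤ 4 ^ n := one_le_pow₀ (by norm_num)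
    refine succ_iff.2 ⟨fun x => ?_, ?_, ?_⟩
    · refine (key _ _).trans ?_
      calc ‖f x‖ * ‖g x‖ ≤ M * N := by
            gcongr
            exacts [hf.norm_le x, hg.norm_le x]
        _ ≤ 2 * 4 ^ (n + 1) * (M * N) := by
            rw [pow_succ]
            nlinarith
    · have hfd := hf.differentiable
      have hgd := hg.differentiable
      intro x
      exact (L.hasFDerivAt_of_bilinear (hfd x).hasFDerivAt (hgd x).hasFDerivAt).differentiableAt
    · have hd : _root_.fderiv ℝ (fun x => L (f x) (g x)) = fun x =>
          L.precompR E (f x) (_root_.fderiv ℝ g x) + L.precompL E (_root_.fderiv ℝ f x) (g x) := by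
        funext x
        exact L.fderiv_of_bilinear (hf.differentiable x) (hg.differentiable x)
      rw [hd]
      -- In each Leibniz term the undifferentiated factor is lowered to order `n` by `of_succ`, at
      -- the cost of a factor `2`. Two such terms give the factor `4` per order.
      have h1 := ih (L.precompR E) ((L.norm_precompR_le E).trans hL) (hf.of_succ hα) hg.fderiv
        (by positivity) hN (fun a b => ((L.precompR E).le_opNorm₂ a b).trans (by
          have := (L.norm_precompR_le E).trans hL
          calc _ ≤ 1 * ‖a‖ * ‖b‖ := by gcongr
            _ = ‖a‖ * ‖b‖ := by ring))
      have h2 := ih (L.precompL E) ((L.norm_precompL_le E).trans hL) hf.fderiv (hg.of_succ hα)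
        hM (by positivity) (fun a b => ((L.precompL E).le_opNorm₂ a b).trans (by
          have := (L.norm_precompL_le E).trans hL
          calc _ ≤ 1 * ‖a‖ * ‖b‖ := by gcongr
            _ = ‖a‖ * ‖b‖ := by ring))
      refine (h1.add h2).mono (le_of_eq ?_)
      ring

/-- Bounds for compositions with maps `Φ` whose derivative is bounded. -/
theorem exists_comp (hα : α ∈ Ioc (0 : ℝ) 1) (n : ℕ) : ∀ K : ℝ, 0 ≤ K → ∃ C : ℝ, 0 ≤ C ∧
    ∀ (F : Type w) [NormedAddCommGroup F] [NormedSpace ℝ F] (f : E → F) (Φ : E → E) (M : ℝ),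
      HolderBound n α M f → Differentiable ℝ Φ → (∀ x, ‖_root_.fderiv ℝ Φ x‖ ≤ K) →
      -- A condition `C^{n-1,α}` on the derivative of `Φ`, void for `n = 0`. Asking for one order
      -- less than `n` here is what later makes the estimate for Euler products linear in the top
      -- order.
      (∀ j, j + 1 = n → HolderBound j α K (_root_.fderiv ℝ Φ)) →
      HolderBound n α (C * M) (fun x => f (Φ x)) := by
  induction n with
  | zero =>
    intro K hK
    refine ⟨1 + K ^ α, by positivity, fun F _ _ f Φ M hf hΦ hΦK _ => ?_⟩
    have hM := hf.nonneg
    obtain ⟨h0, hfc, hf2⟩ := zero_iff.1 hf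
    have hKα : 0 ≤ K ^ α := by positivity
    refine zero_iff.2 ⟨fun x => (h0 _).trans (by nlinarith), hfc.comp hΦ.continuous, fun x y => ?_⟩
    have hL : ‖Φ x - Φ y‖ ≤ K * ‖x - y‖ :=
      Convex.norm_image_sub_le_of_norm_fderiv_le (s := univ) (fun z _ => hΦ z)
        (fun z _ => hΦK z) convex_univ (mem_univ y) (mem_univ x)
    calc ‖f (Φ x) - f (Φ y)‖ ≤ M * ‖Φ x - Φ y‖ ^ α := hf2 _ _
      _ ≤ M * (K * ‖x - y‖) ^ α := by
          have := hα.1.le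
          gcongr
      _ = K ^ α * M * ‖x - y‖ ^ α := by rw [Real.mul_rpow hK (norm_nonneg _)]; ring
      _ ≤ (1 + K ^ α) * M * ‖x - y‖ ^ α := by
          gcongr
          linarith
  | succ n ih =>
    intro K hK
    obtain ⟨C, hC, ih⟩ := ih (2 * K) (by positivity)
    refine ⟨1 + 2 * 4 ^ n * (C * K), by positivity, fun F _ _ f Φ M hf hΦ hΦK hΦn => ?_⟩
    have hM := hf.nonneg
    have hΦn := hΦn n rfl
    have h1 := ih (E →L[ℝ] F) (_root_.fderiv ℝ f) Φ M hf.fderiv hΦ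
      (fun x => (hΦK x).trans (by linarith))
      (fun j hj => by subst hj; exact hΦn.of_succ hα)
    have h2 := h1.bilin hα (ContinuousLinearMap.compL ℝ E E F)
      (ContinuousLinearMap.norm_compL_le ℝ E E F) hΦn
    have hCK : 0 ≤ 2 * 4 ^ n * (C * K) := by positivity
    refine succ_iff.2 ⟨fun x => (hf.norm_le _).trans ?_, hf.differentiable.comp hΦ, ?_⟩
    · nlinarith
    · have hd : _root_.fderiv ℝ (fun x => f (Φ x)) = fun x =>
          ContinuousLinearMap.compL ℝ E E F (_root_.fderiv ℝ f (Φ x)) (_root_.fderiv ℝ Φ x) := by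
        funext x
        exact fderiv_comp x (hf.differentiable _) (hΦ x)
      rw [hd]
      refine h2.mono ?_
      nlinarith

end HolderBound

end HolderBound

end HolderFlow

namespace HolderFlow

universe w

/-! ### Interpolation between sup norms and Hölder norms, and uniform limits. -/

section Interpolation

/-- Positive powers of small numbers are small. -/
theorem exists_mul_rpow_lt (C : ℝ) {γ η : ℝ} (hγ : 0 < γ) (hη : 0 < η) :
    ∃ r ∈ Ioc (0 : ℝ) 1, C * r ^ γ < η := by
  have h : Tendsto (fun r : ℝ => C * r ^ γ) (𝓝[>] 0) (𝓝 (C * 0 ^ γ)) :=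
    ((Real.continuousAt_rpow_const 0 γ (Or.inr hγ.le)).tendsto.const_mul C).mono_left
      nhdsWithin_le_nhds
  rw [Real.zero_rpow hγ.ne', mul_zero] at h
  obtain ⟨r, h1, h2⟩ := ((h.eventually (gt_mem_nhds hη)).and
    (Ioc_mem_nhdsGT (zero_lt_one' ℝ))).exists
  exact ⟨r, h2, h1⟩

variable {E F : Type w} [NormedAddCommGroup E] [NormedSpace ℝ E]
  [NormedAddCommGroup F] [NormedSpace ℝ F]

/-- The derivative of a small function with Hölder derivative is small. -/
theorem norm_fderiv_le_of_holder {α M ε r : ℝ} (hα : 0 < α) (hM : 0 ≤ M) (hr : 0 < r) {g : E → F}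
    (hg : Differentiable ℝ g) (hd : ∀ x y, ‖fderiv ℝ g x - fderiv ℝ g y‖ ≤ M * ‖x - y‖ ^ α) (x : E)
    (hε : ∀ y, ‖y - x‖ ≤ r → ‖g y‖ ≤ ε) : ‖fderiv ℝ g x‖ ≤ 2 * ε / r + M * r ^ α := by
  have h0 : ‖g x‖ ≤ ε := hε x (by simpa using hr.le)
  have hε0 : 0 ≤ ε := (norm_nonneg _).trans h0
  -- First-order Taylor expansion along a vector of length `r`: the two values of `g` contribute `2
  -- * ε` and the remainder `M * r ^ α * r`.
  have key : ∀ v : E, ‖v‖ = r → ‖fderiv ℝ g x v‖ ≤ (2 * ε / r + M * r ^ α) * r := by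
    intro v hv
    have hm : ‖g (x + v) - g x - fderiv ℝ g x (x + v - x)‖ ≤ M * r ^ α * ‖x + v - x‖ := by
      refine Convex.norm_image_sub_le_of_norm_hasFDerivWithin_le' (s := Metric.closedBall x r)
        (f' := fderiv ℝ g) (fun y _ => (hg y).hasFDerivAt.hasFDerivWithinAt) (fun y hy => ?_)
        (convex_closedBall x r) (Metric.mem_closedBall_self hr.le) ?_
      · refine (hd y x).trans ?_
        rw [mem_closedBall_iff_norm] at hy
        gcongr
      · rw [mem_closedBall_iff_norm, add_sub_cancel_left, hv]
    rw [add_sub_cancel_left, hv] at hm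
    have h1 : ‖g (x + v)‖ ≤ ε := hε _ (by rw [add_sub_cancel_left, hv])
    have h2 : fderiv ℝ g x v = g (x + v) - g x - (g (x + v) - g x - fderiv ℝ g x v) := by abel
    have h3 : (2 * ε / r + M * r ^ α) * r = ε + ε + M * r ^ α * r := by field_simp; ring
    rw [h2, h3]
    exact (norm_sub_le _ _).trans (add_le_add ((norm_sub_le _ _).trans (add_le_add h1 h0)) hm)
  refine ContinuousLinearMap.opNorm_le_bound _ (by positivity) fun v => ?_
  rcases eq_or_ne v 0 with rfl | hv
  · simp
  have hv' : 0 < ‖v‖ := norm_pos_iff.2 hv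
  have h1 := key ((r / ‖v‖) • v) (by
    rw [norm_smul, Real.norm_of_nonneg (by positivity)]
    field_simp)
  rw [map_smul, norm_smul, Real.norm_of_nonneg (by positivity)] at h1
  have h2 : r / ‖v‖ * ‖fderiv ℝ g x v‖ = (‖fderiv ℝ g x v‖ / ‖v‖) * r := by ring
  rw [h2] at h1
  exact (div_le_iff₀ hv').1 (le_of_mul_le_mul_right h1 hr)

namespace HolderBound

/-- Makes `norm_fderiv_le_of_holder` available at every order: for `n = 0` the Hölder bound is part
of the hypothesis, and for larger `n` the first derivative is bounded and Lipschitz. -/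
theorem fderiv_sub_le {n : ℕ} {α M : ℝ} {f : E → F} (hα : α ∈ Ioc (0 : ℝ) 1)
    (hf : HolderBound (n + 1) α M f) (x y : E) :
    ‖_root_.fderiv ℝ f x - _root_.fderiv ℝ f y‖ ≤ 2 * M * ‖x - y‖ ^ α := by
  have hM := hf.nonneg
  have h : HolderBound 0 α (2 * M) (_root_.fderiv ℝ f) := by
    clear hM
    induction n with
    | zero => exact hf.fderiv.mono (by linarith [hf.nonneg])
    | succ n ih =>
      have h1 := hf.fderiv
      exact zero_of_lipschitz hα h1.norm_le h1.norm_sub_le le_rfl (by linarith [hf.nonneg])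
  exact (zero_iff.1 h).2.2 x y

/-- Hölder bounds pass to uniform limits. -/
theorem of_tendstoUniformly {α M : ℝ} (hα : α ∈ Ioc (0 : ℝ) 1) {n : ℕ} [CompleteSpace F]
    {f : ℕ → E → F} {g : E → F} (hf : ∀ i, HolderBound n α M (f i))
    (hg : TendstoUniformly f g atTop) : HolderBound n α M g := by
  induction n generalizing F with
  | zero =>
    refine zero_iff.2 ⟨fun x => ?_,
      hg.continuous (Eventually.of_forall fun i => (hf i).1.continuous).frequently, fun x y => ?_⟩
    · exact le_of_tendsto (hg.tendsto_at x).norm (Eventually.of_forall fun i => (hf i).norm_le x)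
    · exact le_of_tendsto ((hg.tendsto_at x).sub (hg.tendsto_at y)).norm
        (Eventually.of_forall fun i => (zero_iff.1 (hf i)).2.2 x y)
  | succ n ih =>
    have hM := (hf 0).nonneg
    -- The differences `f i - f j` are uniformly small with derivatives that are Hölder of constant
    -- `2 * (M + M)`, so their derivatives are small. First `r` is chosen to control the Hölder
    -- term, then the sup distance is taken small relative to `r`.
    have hC : UniformCauchySeqOn (fun i => _root_.fderiv ℝ (f i)) atTop univ := by
      rw [Metric.uniformCauchySeqOn_iff]
      intro ε hε
      obtain ⟨r, ⟨hr, -⟩, hrε⟩ := exists_mul_rpow_lt (4 * M) hα.1 (half_pos hε)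
      have hU := hg.tendstoUniformlyOn (s := univ) |>.uniformCauchySeqOn
      rw [Metric.uniformCauchySeqOn_iff] at hU
      obtain ⟨N, hN⟩ := hU (ε / 4 * r) (by positivity)
      refine ⟨N, fun i hi j hj x _ => ?_⟩
      have hdiff := (hf i).sub (hf j)
      have h1 := norm_fderiv_le_of_holder (ε := ε / 4 * r) hα.1 (by linarith : 0 ≤ 2 * (M + M)) hr
        hdiff.differentiable (hdiff.fderiv_sub_le hα) x (fun y _ => by
          rw [← dist_eq_norm]
          exact (hN i hi j hj y (mem_univ y)).le)
      have h2 : _root_.fderiv ℝ (fun x => f i x - f j x) x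
          = _root_.fderiv ℝ (f i) x - _root_.fderiv ℝ (f j) x :=
        fderiv_fun_sub ((hf i).differentiable x) ((hf j).differentiable x)
      rw [h2] at h1
      rw [dist_eq_norm]
      refine h1.trans_lt ?_
      have h3 : 2 * (ε / 4 * r) / r = ε / 2 := by field_simp; ring
      rw [h3]
      linarith
    have hlim : ∀ x, ∃ A, Tendsto (fun i => _root_.fderiv ℝ (f i) x) atTop (𝓝 A) := fun x =>
      cauchySeq_tendsto_of_complete (hC.cauchySeq (mem_univ x))
    choose A hA using hlim
    have hAu : TendstoUniformly (fun i => _root_.fderiv ℝ (f i)) A atTop :=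
      tendstoUniformlyOn_univ.1 (hC.tendstoUniformlyOn_of_tendsto fun x _ => hA x)
    have hder : ∀ x, HasFDerivAt g (A x) x := hasFDerivAt_of_tendstoUniformly hAu
      (fun i x => ((hf i).differentiable x).hasFDerivAt) (fun x => hg.tendsto_at x)
    have hA' : _root_.fderiv ℝ g = A := funext fun x => (hder x).fderiv
    refine succ_iff.2 ⟨fun x => ?_, fun x => (hder x).differentiableAt, ?_⟩
    · exact le_of_tendsto (hg.tendsto_at x).norm (Eventually.of_forall fun i => (hf i).norm_le x)
    · rw [hA']
      exact ih (fun i => (hf i).fderiv) hAu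

/-- If a function with Hölder bounds tends to `0` at infinity, so do its derivatives. -/
theorem tendsto_iteratedFDeriv {α M : ℝ} (hα : α ∈ Ioc (0 : ℝ) 1) {n : ℕ} {g : E → F}
    (hg : HolderBound n α M g) (h0 : Tendsto g (Bornology.cobounded E) (𝓝 0)) :
    ∀ l ≤ n, Tendsto (iteratedFDeriv ℝ l g) (Bornology.cobounded E) (𝓝 0) := by
  induction n generalizing F with
  | zero =>
    intro l hl
    obtain rfl : l = 0 := by omega
    rw [tendsto_zero_iff_norm_tendsto_zero] at h0 ⊢
    simpa using h0
  | succ n ih =>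
    intro l hl
    cases l with
    | zero =>
      rw [tendsto_zero_iff_norm_tendsto_zero] at h0 ⊢
      simpa using h0
    | succ l =>
      have hM := hg.nonneg
      have h1 : Tendsto (_root_.fderiv ℝ g) (Bornology.cobounded E) (𝓝 0) := by
        rw [Metric.tendsto_nhds] at h0 ⊢
        intro ε hε
        obtain ⟨r, ⟨hr, -⟩, hrε⟩ := exists_mul_rpow_lt (2 * M) hα.1 (half_pos hε)
        have h2 := h0 (ε / 4 * r) (by positivity)
        rw [← comap_norm_atTop, eventually_comap, eventually_atTop] at h2 ⊢
        obtain ⟨R, hR⟩ := h2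
        -- The whole ball of radius `r` around `x` has to stay outside the ball of radius `R`.
        refine ⟨R + r, fun b hb x hx => ?_⟩
        have h1 := norm_fderiv_le_of_holder (ε := ε / 4 * r) hα.1 (by linarith : 0 ≤ 2 * M) hr
          hg.differentiable (hg.fderiv_sub_le hα) x (fun y hy => by
            have h3 : ‖x‖ ≤ ‖y‖ + ‖y - x‖ := by
              have := _root_.norm_sub_le y (y - x)
              rwa [sub_sub_cancel] at this
            have := hR ‖y‖ (by linarith) y rfl
            rw [dist_zero_right] at this
            exact this.le)
        rw [dist_zero_right]
        refine h1.trans_lt ?_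
        have h3 : 2 * (ε / 4 * r) / r = ε / 2 := by field_simp; ring
        rw [h3]
        linarith
      have h2 := ih hg.fderiv h1 l (by omega)
      rw [tendsto_zero_iff_norm_tendsto_zero] at h2 ⊢
      simpa only [norm_iteratedFDeriv_fderiv] using h2

/-- The interpolation inequality: a bound in `C^{n,α}` and smallness in `C^0` imply smallness in
`C^{n,α'}` for `α' < α`. -/
theorem exists_interpolation {α α' : ℝ} (hα : α ∈ Ioc (0 : ℝ) 1) (hα' : α' ∈ Ioo 0 α) (n : ℕ) :
    ∀ M B : ℝ, 0 ≤ M → 0 < B → ∃ C γ : ℝ, 0 ≤ C ∧ 0 < γ ∧ γ ≤ 1 ∧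
      ∀ (F : Type w) [NormedAddCommGroup F] [NormedSpace ℝ F] (g : E → F) (ε : ℝ), 0 < ε → ε ≤ B →
        HolderBound n α M g → (∀ x, ‖g x‖ ≤ ε) → HolderBound n α' (C * ε ^ γ) g := by
  have hαp := hα.1
  have hαp' := hα'.1
  induction n with
  | zero =>
    intro M B hM hB
    set θ := α' / α with hθ
    have hθ0 : 0 < θ := div_pos hαp' hαp
    have hθ1 : θ < 1 := (div_lt_one hαp).2 hα'.2
    -- `B ^ θ` serves the sup bound, by `ε = ε ^ θ * ε ^ (1 - θ)`. The other term comes from writing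
    -- the oscillation as `D ^ (1 - θ) * D ^ θ` and using `D ≤ 2 * ε` in one factor and the
    -- `α`-Hölder bound in the other.
    refine ⟨B ^ θ + 2 ^ (1 - θ) * M ^ θ, 1 - θ, by positivity, by linarith, by linarith,
      fun F _ _ g ε hε hεB hg hgε => ?_⟩
    have hg2 := (zero_iff.1 hg).2.2
    refine zero_iff.2 ⟨fun x => (hgε x).trans ?_, (zero_iff.1 hg).2.1, fun x y => ?_⟩
    · calc ε = ε ^ θ * ε ^ (1 - θ) := by
            rw [← Real.rpow_add hε]; simp
        _ ≤ B ^ θ * ε ^ (1 - θ) := by gcongr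
        _ ≤ _ := by
          gcongr
          have : 0 ≤ 2 ^ (1 - θ) * M ^ θ := by positivity
          linarith
    · set D := ‖g x - g y‖ with hD
      have hD0 : 0 ≤ D := norm_nonneg _
      have h1 : D ≤ 2 * ε := (_root_.norm_sub_le _ _).trans (by linarith [hgε x, hgε y])
      calc D = D ^ (1 - θ) * D ^ θ := by
            rw [← Real.rpow_add_of_nonneg hD0 (by linarith) hθ0.le]; simp
        _ ≤ (2 * ε) ^ (1 - θ) * (M * ‖x - y‖ ^ α) ^ θ := by
            have : 0 ≤ 1 - θ := by linarith
            gcongr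
            exact hg2 x y
        _ = (2 ^ (1 - θ) * M ^ θ) * ε ^ (1 - θ) * ‖x - y‖ ^ α' := by
            rw [Real.mul_rpow (by norm_num) hε.le, Real.mul_rpow hM (by positivity),
              ← Real.rpow_mul (norm_nonneg _), hθ, mul_div_cancel₀ _ hαp.ne']
            ring
        _ ≤ _ := by
            gcongr
            have : 0 ≤ B ^ θ := by positivity
            linarith
  | succ n ih =>
    intro M B hM hB
    -- Taylor expansion at radius `ε ^ (1 / 2)` bounds the derivative by `2 * ε ^ (1 / 2) + 2 * M *
    -- ε ^ (α / 2)`, hence by `K * ε ^ δ`. The induction hypothesis then applies to the derivative.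
    set δ : ℝ := α / 2 with hδ
    have hδ0 : 0 < δ := by positivity
    have hδ1 : 0 ≤ 1 / 2 - δ := by linarith [hα.2]
    set K : ℝ := 2 * B ^ (1 / 2 - δ) + 2 * M with hK
    have hK0 : 0 < K := by positivity
    obtain ⟨C, γ, hC, hγ, hγ1, ih⟩ := ih M (K * B ^ δ) hM (by positivity)
    have hγδ : γ * δ ≤ 1 := by nlinarith [hα.2]
    refine ⟨C * K ^ γ + B ^ (1 - γ * δ), γ * δ, by positivity, by positivity, hγδ,
      fun F _ _ g ε hε hεB hg hgε => ?_⟩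
    have hr : 0 < ε ^ (1 / 2 : ℝ) := by positivity
    have hd : ∀ x, ‖_root_.fderiv ℝ g x‖ ≤ K * ε ^ δ := fun x => by
      have h1 := norm_fderiv_le_of_holder hαp (by linarith : 0 ≤ 2 * M) hr hg.differentiable
        (hg.fderiv_sub_le hα) x (fun y _ => hgε y)
      have h2 : 2 * ε / ε ^ (1 / 2 : ℝ) = 2 * ε ^ (1 / 2 : ℝ) := by
        have : ε = ε ^ (1 / 2 : ℝ) * ε ^ (1 / 2 : ℝ) := by
          rw [← Real.rpow_add hε]; norm_num
        rw [div_eq_iff hr.ne', mul_assoc, ← this]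
      have h3 : ε ^ (1 / 2 : ℝ) ≤ B ^ (1 / 2 - δ) * ε ^ δ := by
        calc ε ^ (1 / 2 : ℝ) = ε ^ (1 / 2 - δ) * ε ^ δ := by rw [← Real.rpow_add hε]; simp
          _ ≤ _ := by gcongr
      rw [h2, ← Real.rpow_mul hε.le, one_div_mul_eq_div, ← hδ] at h1
      refine h1.trans ?_
      rw [hK]
      nlinarith
    have h1 := ih (E →L[ℝ] F) (_root_.fderiv ℝ g) (K * ε ^ δ) (by positivity) (by gcongr)
      hg.fderiv hd
    have h2 : C * (K * ε ^ δ) ^ γ = C * K ^ γ * ε ^ (γ * δ) := by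
      rw [Real.mul_rpow hK0.le (by positivity), ← Real.rpow_mul hε.le, mul_comm δ γ, mul_assoc]
    have hB0 : 0 ≤ B ^ (1 - γ * δ) := by positivity
    have hCK : 0 ≤ C * K ^ γ := by positivity
    refine succ_iff.2 ⟨fun x => (hgε x).trans ?_, hg.differentiable, h1.mono ?_⟩
    · calc ε = ε ^ (1 - γ * δ) * ε ^ (γ * δ) := by rw [← Real.rpow_add hε]; simp
        _ ≤ B ^ (1 - γ * δ) * ε ^ (γ * δ) := by
            have : 0 ≤ 1 - γ * δ := by linarith
            gcongr
        _ ≤ _ := by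
            gcongr
            linarith
    · rw [h2]
      gcongr
      linarith

end HolderBound

end Interpolation

end HolderFlow

namespace HolderFlow

/-! ### Euler maps -/

section Euler

/-- The discrete Gronwall inequality. -/
theorem discrete_gronwall {e m c : ℕ → ℝ} (hm : ∀ j, 0 ≤ m j) (hc : ∀ j, 0 ≤ c j) (h0 : e 0 ≤ 0)
    (he : ∀ j, e (j + 1) ≤ (1 + m j) * e j + c j) (N : ℕ) :
    e N ≤ Real.exp (∑ j ∈ Finset.range N, m j) * ∑ j ∈ Finset.range N, c j := by
  induction N with
  | zero => simpa using h0
  | succ N ih =>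
    rw [Finset.sum_range_succ, Finset.sum_range_succ, Real.exp_add]
    have h1 : 1 + m N ≤ Real.exp (m N) := by linarith [Real.add_one_le_exp (m N)]
    have h2 : 1 ≤ Real.exp (m N) := Real.one_le_exp (hm N)
    have hs : 0 ≤ ∑ j ∈ Finset.range N, m j := Finset.sum_nonneg fun j _ => hm j
    have h3 : 1 ≤ Real.exp (∑ j ∈ Finset.range N, m j) := Real.one_le_exp hs
    have hs' : 0 ≤ ∑ j ∈ Finset.range N, c j := Finset.sum_nonneg fun j _ => hc j
    have := hm N
    calc e (N + 1) ≤ (1 + m N) * e N + c N := he N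
      _ ≤ (1 + m N) * (Real.exp (∑ j ∈ Finset.range N, m j) * ∑ j ∈ Finset.range N, c j) + c N := by
          gcongr
      _ ≤ Real.exp (m N) * (Real.exp (∑ j ∈ Finset.range N, m j) * ∑ j ∈ Finset.range N, c j)
          + (Real.exp (∑ j ∈ Finset.range N, m j) * Real.exp (m N)) * c N := by
          gcongr
          exact le_mul_of_one_le_left (hc N) (one_le_mul_of_one_le_of_one_le h3 h2)
      _ = _ := by ring

universe w

variable {E : Type w} [NormedAddCommGroup E]

/-- The composition `(id + f_{N-1}) ∘ ⋯ ∘ (id + f_0)`. -/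
def eulerMap (f : ℕ → E → E) : ℕ → E → E
  | 0, x => x
  | N + 1, x => eulerMap f N x + f N (eulerMap f N x)

/-- Stability of the Euler scheme. -/
theorem norm_eulerMap_sub_le {f : ℕ → E → E} {m c : ℕ → ℝ} (hm : ∀ j, 0 ≤ m j)
    (hf : ∀ j x y, ‖f j x - f j y‖ ≤ m j * ‖x - y‖) {z : ℕ → E}
    (hz : ∀ j, ‖z (j + 1) - z j - f j (z j)‖ ≤ c j) (N : ℕ) :
    ‖eulerMap f N (z 0) - z N‖ ≤
      Real.exp (∑ j ∈ Finset.range N, m j) * ∑ j ∈ Finset.range N, c j := by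
  refine discrete_gronwall (e := fun j => ‖eulerMap f j (z 0) - z j‖) hm
    (fun j => (norm_nonneg _).trans (hz j)) (by simp [eulerMap]) (fun j => ?_) N
  have h : eulerMap f (j + 1) (z 0) - z (j + 1) = (eulerMap f j (z 0) - z j)
      + (f j (eulerMap f j (z 0)) - f j (z j)) - (z (j + 1) - z j - f j (z j)) := by
    rw [eulerMap]; abel
  rw [h, add_mul, one_mul]
  exact (norm_sub_le _ _).trans (add_le_add ((norm_add_le _ _).trans (by gcongr; exact hf _ _ _))
    (hz j))

theorem norm_eulerMap_sub_id_le {f : ℕ → E → E} {m : ℕ → ℝ} (hf : ∀ j x, ‖f j x‖ ≤ m j) (N : ℕ)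
    (x : E) : ‖eulerMap f N x - x‖ ≤ ∑ j ∈ Finset.range N, m j := by
  induction N with
  | zero => simp [eulerMap]
  | succ N ih =>
    rw [Finset.sum_range_succ, eulerMap, add_sub_right_comm]
    exact (norm_add_le _ _).trans (add_le_add ih (hf _ _))

/-- The Euler maps are injective with a lower Lipschitz bound, if the steps are small. -/
theorem le_norm_eulerMap_sub {f : ℕ → E → E} {m : ℕ → ℝ} (hm : ∀ j, m j ∈ Icc (0 : ℝ) (1 / 2))
    (hf : ∀ j x y, ‖f j x - f j y‖ ≤ m j * ‖x - y‖) (N : ℕ) (x y : E) :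
    Real.exp (-2 * ∑ j ∈ Finset.range N, m j) * ‖x - y‖ ≤ ‖eulerMap f N x - eulerMap f N y‖ := by
  induction N with
  | zero => simp [eulerMap]
  | succ N ih =>
    set X := eulerMap f N x
    set Y := eulerMap f N y
    -- This is where `m N ≤ 1 / 2` enters: it gives `(1 - m) * (1 + 2 * m) ≥ 1`.
    have h1 : Real.exp (-2 * m N) ≤ 1 - m N := by
      have h2 : 1 + 2 * m N ≤ Real.exp (2 * m N) := by linarith [Real.add_one_le_exp (2 * m N)]
      have h3 : Real.exp (-2 * m N) * Real.exp (2 * m N) = 1 := by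
        rw [← Real.exp_add]; simp
      have h4 := Real.exp_pos (-2 * m N)
      have h5 := (hm N).1
      have h6 := (hm N).2
      have h7 : Real.exp (-2 * m N) * (1 + 2 * m N) ≤ 1 := by
        calc _ ≤ Real.exp (-2 * m N) * Real.exp (2 * m N) := by gcongr
          _ = 1 := h3
      nlinarith
    have h2 : ‖X - Y‖ ≤ ‖eulerMap f (N + 1) x - eulerMap f (N + 1) y‖ + m N * ‖X - Y‖ := by
      have : X - Y = (eulerMap f (N + 1) x - eulerMap f (N + 1) y) - (f N X - f N Y) := by
        simp only [eulerMap, X, Y]; abel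
      calc ‖X - Y‖ = _ := by rw [this]
        _ ≤ _ := (norm_sub_le _ _).trans (add_le_add le_rfl (hf _ _ _))
    rw [Finset.sum_range_succ, mul_add, add_comm, Real.exp_add, mul_assoc]
    calc _ ≤ Real.exp (-2 * m N) * ‖X - Y‖ := by gcongr
      _ ≤ (1 - m N) * ‖X - Y‖ := by gcongr
      _ ≤ _ := by linarith

variable [NormedSpace ℝ E]

theorem differentiable_eulerMap {f : ℕ → E → E} (hf : ∀ j, Differentiable ℝ (f j)) (N : ℕ) :
    Differentiable ℝ (eulerMap f N) := by
  induction N with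
  | zero => exact differentiable_id
  | succ N ih => exact ih.add ((hf N).comp ih)

theorem fderiv_eulerMap_succ {f : ℕ → E → E} (hf : ∀ j, Differentiable ℝ (f j)) (N : ℕ) (x : E) :
    fderiv ℝ (eulerMap f (N + 1)) x = fderiv ℝ (eulerMap f N) x
      + ContinuousLinearMap.compL ℝ E E E (fderiv ℝ (f N) (eulerMap f N x))
        (fderiv ℝ (eulerMap f N) x) := by
  have h := differentiable_eulerMap hf N
  exact ((h x).hasFDerivAt.add (((hf N) _).hasFDerivAt.comp x (h x).hasFDerivAt)).fderiv

theorem fderiv_eulerMap_zero (f : ℕ → E → E) :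
    fderiv ℝ (eulerMap f 0) = fun _ => ContinuousLinearMap.id ℝ E :=
  funext fun _ => fderiv_id

theorem norm_fderiv_eulerMap_le {f : ℕ → E → E} {m : ℕ → ℝ} (hf : ∀ j, Differentiable ℝ (f j))
    (hfm : ∀ j x, ‖fderiv ℝ (f j) x‖ ≤ m j) (N : ℕ) (x : E) :
    ‖fderiv ℝ (eulerMap f N) x‖ ≤ Real.exp (∑ j ∈ Finset.range N, m j) := by
  induction N with
  | zero =>
    rw [fderiv_eulerMap_zero]
    simpa using ContinuousLinearMap.norm_id_le
  | succ N ih =>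
    rw [fderiv_eulerMap_succ hf, Finset.sum_range_succ, Real.exp_add]
    have h1 : 1 + m N ≤ Real.exp (m N) := by linarith [Real.add_one_le_exp (m N)]
    have h2 : 0 ≤ m N := (norm_nonneg _).trans (hfm N x)
    calc _ ≤ ‖fderiv ℝ (eulerMap f N) x‖ + m N * ‖fderiv ℝ (eulerMap f N) x‖ := by
          refine (norm_add_le _ _).trans ?_
          gcongr
          refine (ContinuousLinearMap.opNorm_comp_le _ _).trans ?_
          gcongr
          exact hfm _ _
      _ = ‖fderiv ℝ (eulerMap f N) x‖ * (1 + m N) := by ring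
      _ ≤ _ := by gcongr

/-- One more derivative of the Euler maps can be controlled. -/
theorem exists_holderBound_fderiv_eulerMap_aux {α : ℝ} (hα : α ∈ Ioc (0 : ℝ) 1) (n : ℕ) {K : ℝ}
    (hK : 0 ≤ K) : ∃ C : ℝ, 0 ≤ C ∧ ∀ (f : ℕ → E → E) (m : ℕ → ℝ) (N : ℕ),
      (∀ j, HolderBound (n + 1) α (m j) (f j)) →
      (∀ i ≤ N, ∀ x, ‖fderiv ℝ (eulerMap f i) x‖ ≤ K) →
      (∀ i ≤ N, ∀ j, j + 1 = n → HolderBound j α K (fderiv ℝ (eulerMap f i))) →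
      ∀ i ≤ N, HolderBound n α (Real.exp (C * ∑ j ∈ Finset.range i, m j))
        (fderiv ℝ (eulerMap f i)) := by
  obtain ⟨C, hC, hcomp⟩ := HolderBound.exists_comp (E := E) hα n K hK
  refine ⟨2 * 4 ^ n * C, by positivity, fun f m N hf hs hn i hi => ?_⟩
  have hfd : ∀ j, Differentiable ℝ (f j) := fun j => (hf j).differentiable
  induction i with
  | zero =>
    rw [fderiv_eulerMap_zero]
    exact HolderBound.const (by simpa using ContinuousLinearMap.norm_id_le)
  | succ i ih =>
    have hi' : i ≤ N := by omega
    -- The composed factor is bounded by `C * m i` using only lower-order bounds on the Euler map.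
    -- The chain rule is therefore linear in the order-`n` bound of its derivative, and that bound
    -- grows by the factor `1 + 2 * 4 ^ n * C * m i`.
    have h1 := hcomp (E →L[ℝ] E) _ _ _ (hf i).fderiv (differentiable_eulerMap hfd i) (hs i hi')
      (hn i hi')
    have h2 := h1.bilin hα (ContinuousLinearMap.compL ℝ E E E)
      (ContinuousLinearMap.norm_compL_le ℝ E E E) (ih hi')
    rw [funext (fderiv_eulerMap_succ hfd i)]
    refine ((ih hi').add h2).mono ?_
    rw [Finset.sum_range_succ, mul_add (2 * 4 ^ n * C), Real.exp_add]
    set x := 2 * 4 ^ n * C * m i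
    have h3 : 1 + x ≤ Real.exp x := by linarith [Real.add_one_le_exp x]
    set y := Real.exp (2 * 4 ^ n * C * ∑ j ∈ Finset.range i, m j)
    calc y + 2 * 4 ^ n * (C * m i * y) = y * (1 + x) := by simp only [x]; ring
      _ ≤ y * Real.exp x := by gcongr

/-- Bootstrapping: the bound at order `n` supplies the composition constant needed at order `n + 1`,
starting from the sup bound `exp R`. The constant depends on the sum of the `m j` but not on `N`, so
it survives refinement of the partition. The induction hypothesis is used with `2 * R` because
`of_succ` doubles each `m j`. -/
theorem exists_holderBound_fderiv_eulerMap {α : ℝ} (hα : α ∈ Ioc (0 : ℝ) 1) (n : ℕ) : ∀ R : ℝ,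
    0 ≤ R → ∃ C : ℝ, 0 ≤ C ∧ ∀ (f : ℕ → E → E) (m : ℕ → ℝ) (N : ℕ),
      (∀ j, HolderBound (n + 1) α (m j) (f j)) → ∑ j ∈ Finset.range N, m j ≤ R →
      ∀ i ≤ N, HolderBound n α C (fderiv ℝ (eulerMap f i)) := by
  have hpart : ∀ {n : ℕ} {f : ℕ → E → E} {m : ℕ → ℝ} {N : ℕ} {R : ℝ},
      (∀ j, HolderBound (n + 1) α (m j) (f j)) → ∑ j ∈ Finset.range N, m j ≤ R →
      ∀ i ≤ N, ∑ j ∈ Finset.range i, m j ≤ R := fun hf hR i hi =>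
    (Finset.sum_le_sum_of_subset_of_nonneg (Finset.range_mono hi)
      fun j _ _ => (hf j).nonneg).trans hR
  induction n with
  | zero =>
    intro R hR
    obtain ⟨C, hC, h⟩ := exists_holderBound_fderiv_eulerMap_aux (E := E) hα 0 (Real.exp_nonneg R)
    refine ⟨Real.exp (C * R), by positivity, fun f m N hf hfR i hi => ?_⟩
    refine (h f m N hf (fun i hi x => ?_) (fun i hi j hj => by omega) i hi).mono ?_
    · refine (norm_fderiv_eulerMap_le (fun j => (hf j).differentiable)
        (fun j => (hf j).fderiv.norm_le) i x).trans ?_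
      gcongr
      exact hpart hf hfR i hi
    · gcongr
      exact hpart hf hfR i hi
  | succ n ih =>
    intro R hR
    obtain ⟨K, hK, ih⟩ := ih (2 * R) (by positivity)
    obtain ⟨C, hC, h⟩ := exists_holderBound_fderiv_eulerMap_aux (E := E) hα (n + 1) hK
    refine ⟨Real.exp (C * R), by positivity, fun f m N hf hfR i hi => ?_⟩
    have ih' := ih f (fun j => 2 * m j) N (fun j => (hf j).of_succ hα)
      (by rw [← Finset.mul_sum]; linarith)
    refine (h f m N hf (fun i hi x => (ih' i hi).norm_le x) (fun i hi j hj => ?_) i hi).mono ?_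
    · obtain rfl : j = n := by omega
      exact ih' i hi
    · gcongr
      exact hpart hf hfR i hi

/-- Uniform Hölder bounds for the Euler maps. -/
theorem exists_holderBound_eulerMap {α : ℝ} (hα : α ∈ Ioc (0 : ℝ) 1) (n : ℕ) {R : ℝ}
    (hR : 0 ≤ R) : ∃ C : ℝ, 0 ≤ C ∧ ∀ (f : ℕ → E → E) (m : ℕ → ℝ) (N : ℕ),
      (∀ j, HolderBound (n + 1) α (m j) (f j)) → ∑ j ∈ Finset.range N, m j ≤ R →
      HolderBound (n + 1) α C (fun x => eulerMap f N x - x) := by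
  obtain ⟨C, hC, h⟩ := exists_holderBound_fderiv_eulerMap (E := E) hα n R hR
  refine ⟨C + 1 + R, by positivity, fun f m N hf hfR => ?_⟩
  have hd := differentiable_eulerMap (fun j => (hf j).differentiable) N
  refine HolderBound.succ_iff.2 ⟨fun x => ?_, hd.sub differentiable_id, ?_⟩
  · exact (norm_eulerMap_sub_id_le (fun j => (hf j).norm_le) N x).trans (by linarith)
  · have h1 : fderiv ℝ (fun x => eulerMap f N x - x)
        = fun x => fderiv ℝ (eulerMap f N) x - ContinuousLinearMap.id ℝ E := by
      funext x
      rw [fderiv_fun_sub (hd x) differentiableAt_fun_id, fderiv_fun_id]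
    rw [h1]
    exact ((h f m N hf hfR N le_rfl).sub
      (HolderBound.const ContinuousLinearMap.norm_id_le)).mono (by linarith)

end Euler

end HolderFlow

namespace HolderFlow

/-! ### The Banach spaces `C^{n,α}_0` -/

namespace C0Holder

variable {n : ℕ} {α : ℝ} {d : ℕ}

theorem holderBound (hα : 0 < α) (f : C0Holder n α d) : HolderBound n α ‖f‖ f := by
  refine ⟨f.2.1, fun l hl x => ?_, fun x y => ?_⟩
  · rw [norm_def, ← toReal_enorm]
    exact ENNReal.toReal_mono f.2.2.1.ne (enorm_le_eHolderNorm α f.1 hl x)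
  · rcases eq_or_ne x y with rfl | hxy
    · simp [Real.zero_rpow hα.ne']
    · have h := ENNReal.toReal_mono f.2.2.1.ne (quotient_le_eHolderNorm n α f.1 hxy)
      rw [ENNReal.toReal_div, ← ENNReal.toReal_rpow, toReal_enorm, toReal_enorm] at h
      have hpos : 0 < ‖x - y‖ ^ α := Real.rpow_pos_of_pos (norm_pos_iff.2 (sub_ne_zero.2 hxy)) _
      exact (div_le_iff₀ hpos).1 h

theorem eHolderNorm_le {M : ℝ} (hα : 0 ≤ α) {f : Space d → Space d} (hf : HolderBound n α M f) :
    eHolderNorm n α f ≤ ENNReal.ofReal M := by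
  refine max_le ?_ ?_
  · refine iSup_le fun l => iSup_le fun hl => iSup_le fun x => ?_
    rw [← ofReal_norm]
    exact ENNReal.ofReal_le_ofReal (hf.2.1 l hl x)
  · refine iSup_le fun x => iSup_le fun y => iSup_le fun hxy => ?_
    refine ENNReal.div_le_of_le_mul ?_
    rw [← ofReal_norm, ← ofReal_norm, ENNReal.ofReal_rpow_of_nonneg (norm_nonneg _) hα,
      ← ENNReal.ofReal_mul hf.nonneg]
    exact ENNReal.ofReal_le_ofReal (hf.2.2 x y)

/-- Decay need only be known for `f` itself; interpolation passes it on to the derivatives. -/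
theorem mem_of_holderBound {M : ℝ} (hα : α ∈ Ioc (0 : ℝ) 1) {f : Space d → Space d}
    (hf : HolderBound n α M f) (h0 : Tendsto f (Bornology.cobounded _) (𝓝 0)) :
    f ∈ c0HolderSubmodule n α d :=
  ⟨hf.1, (eHolderNorm_le hα.1.le hf).trans_lt ENNReal.ofReal_lt_top,
    hf.tendsto_iteratedFDeriv hα h0⟩

theorem norm_le_of_holderBound {M : ℝ} (hα : 0 ≤ α) {f : C0Holder n α d}
    (hf : HolderBound n α M f) : ‖f‖ ≤ M :=
  ENNReal.toReal_le_of_le_ofReal hf.nonneg (eHolderNorm_le hα hf)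

theorem norm_apply_le (hα : 0 < α) (f : C0Holder n α d) (x : Space d) : ‖f x‖ ≤ ‖f‖ :=
  (f.holderBound hα).norm_le x

theorem sub_apply (f g : C0Holder n α d) (x : Space d) : (f - g) x = f x - g x := rfl

theorem norm_sub_apply_le (hα : 0 < α) (f : C0Holder (n + 1) α d) (x y : Space d) :
    ‖f x - f y‖ ≤ ‖f‖ * ‖x - y‖ := (f.holderBound hα).norm_sub_le x y

theorem tendsto_zero (f : C0Holder n α d) : Tendsto f (Bornology.cobounded _) (𝓝 0) := by
  have h := f.2.2.2 0 (Nat.zero_le n)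
  rw [tendsto_zero_iff_norm_tendsto_zero] at h ⊢
  simpa using h

/-- The evaluation at a point. -/
noncomputable def eval (hα : 0 < α) (x : Space d) : C0Holder n α d →L[ℝ] Space d :=
  LinearMap.mkContinuous
    { toFun := fun f => f x
      map_add' := fun _ _ => rfl
      map_smul' := fun _ _ => rfl } 1 (fun f => (f.norm_apply_le hα x).trans_eq (one_mul _).symm)

/-- Joint continuity of evaluation yields the measurability of `s ↦ u s (y s)` for continuous `y`.
-/
theorem continuous_uncurry (hα : 0 < α) :
    Continuous fun p : C0Holder n α d × Space d => p.1 p.2 := by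
  refine continuous_iff_continuousAt.2 fun ⟨f, x⟩ => ?_
  rw [ContinuousAt, tendsto_iff_norm_sub_tendsto_zero]
  have hc : Continuous f := f.2.1.continuous
  have h : Tendsto (fun p : C0Holder n α d × Space d => ‖p.1 - f‖ + ‖f p.2 - f x‖) (𝓝 (f, x))
      (𝓝 (‖f - f‖ + ‖f x - f x‖)) := Continuous.tendsto (by fun_prop) (f, x)
  rw [sub_self, sub_self, norm_zero, norm_zero, add_zero] at h
  refine squeeze_zero (fun _ => norm_nonneg _) (fun p => ?_) h
  have h1 : p.1 p.2 - f x = (p.1 - f) p.2 + (f p.2 - f x) := by rw [sub_apply]; abel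
  exact (congrArg norm h1).le.trans
    ((norm_add_le _ _).trans (add_le_add (norm_apply_le hα _ _) le_rfl))

/-- Needed so that Bochner integrals of the field commute with evaluation at points. -/
theorem completeSpace (hα : α ∈ Ioc (0 : ℝ) 1) : CompleteSpace (C0Holder n α d) := by
  refine Metric.complete_of_cauchySeq_tendsto fun f hf => ?_
  have hC : UniformCauchySeqOn (fun i x => f i x) atTop univ := by
    rw [Metric.uniformCauchySeqOn_iff]
    intro ε hε
    obtain ⟨N, hN⟩ := Metric.cauchySeq_iff.1 hf ε hε
    refine ⟨N, fun i hi j hj x _ => ?_⟩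
    have h := hN i hi j hj
    rw [dist_eq_norm] at h ⊢
    exact (norm_apply_le hα.1 (f i - f j) x).trans_lt h
  have hlim : ∀ x, ∃ A, Tendsto (fun i => f i x) atTop (𝓝 A) := fun x =>
    cauchySeq_tendsto_of_complete (hC.cauchySeq (mem_univ x))
  choose g hg using hlim
  have hgu : TendstoUniformly (fun i x => f i x) g atTop :=
    tendstoUniformlyOn_univ.1 (hC.tendstoUniformlyOn_of_tendsto fun x _ => hg x)
  obtain ⟨M, hM⟩ := hf.isBounded_range.exists_norm_le
  have hgM : HolderBound n α M g := HolderBound.of_tendstoUniformly hα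
    (fun i => ((f i).holderBound hα.1).mono (hM _ (mem_range_self i))) hgu
  have hg0 : Tendsto g (Bornology.cobounded _) (𝓝 0) :=
    hgu.tendsto_of_eventually_tendsto (Eventually.of_forall fun i => (f i).tendsto_zero)
      tendsto_const_nhds
  let G : C0Holder n α d := ⟨g, mem_of_holderBound hα hgM hg0⟩
  refine ⟨G, ?_⟩
  rw [Metric.tendsto_atTop]
  intro ε hε
  obtain ⟨N, hN⟩ := Metric.cauchySeq_iff.1 hf (ε / 2) (half_pos hε)
  refine ⟨N, fun i hi => ?_⟩
  rw [dist_eq_norm]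
  refine (norm_le_of_holderBound (M := ε / 2) hα.1.le ?_).trans_lt (half_lt_self hε)
  -- Convergence in norm: the bound `ε / 2` on `f i - f (j + N)` passes to the uniform limit in `j`.
  refine HolderBound.of_tendstoUniformly (f := fun j x => f i x - f (j + N) x) hα (fun j => ?_) ?_
  · have h := hN i hi (j + N) (by omega)
    rw [dist_eq_norm] at h
    exact ((f i - f (j + N)).holderBound hα.1).mono h.le
  · rw [Metric.tendstoUniformly_iff] at hgu ⊢
    intro δ hδ
    filter_upwards [(tendsto_add_atTop_nat N).eventually (hgu δ hδ)] with j hj x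
    have : G x = g x := rfl
    rw [sub_apply, this, dist_sub_left]
    exact hj x

end C0Holder

end HolderFlow

namespace HolderFlow

/-! ### Integrals over subintervals of `[0,1]` -/

section Integrals

variable {V : Type*} [NormedAddCommGroup V]

/-- Absolute continuity of the integral, uniform in the position of the interval. It controls both
the continuity of flows in time and the fineness of partitions. -/
theorem exists_integral_Ioc_norm_lt {g : I → V} (hg : Integrable g volume) {ε : ℝ} (hε : 0 < ε) :
    ∃ δ > 0, ∀ s t : I, (t : ℝ) - s < δ → ∫ r in Ioc s t, ‖g r‖ < ε := by
  obtain ⟨δ, hδ, h⟩ := exists_pos_setLIntegral_lt_of_measure_lt (μ := (volume : Measure I))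
    (f := fun r => ‖g r‖ₑ) hg.2.ne (ENNReal.ofReal_pos.2 hε).ne'
  obtain ⟨δ', hδ', hδδ'⟩ := ENNReal.lt_iff_exists_nnreal_btwn.1 hδ
  refine ⟨δ', by exact_mod_cast hδ', fun s t hst => ?_⟩
  rw [integral_norm_eq_lintegral_enorm hg.1.restrict]
  refine ENNReal.toReal_lt_of_lt_ofReal (h _ ?_)
  rw [unitInterval.volume_Ioc]
  refine lt_of_le_of_lt (ENNReal.ofReal_le_ofReal hst.le) ?_
  simpa using hδδ'

variable [NormedSpace ℝ V]

theorem setIntegral_Iic_sub {g : I → V} (hg : Integrable g volume) {s t : I} (hst : s ≤ t) :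
    (∫ r in Iic t, g r) - ∫ r in Iic s, g r = ∫ r in Ioc s t, g r := by
  rw [← Iic_union_Ioc_eq_Iic hst, setIntegral_union (Iic_disjoint_Ioc le_rfl) measurableSet_Ioc
    hg.integrableOn hg.integrableOn, add_sub_cancel_left]

theorem setIntegral_Iic_zero (g : I → V) : ∫ r in Iic (0 : I), g r = 0 := by
  have : volume (Iic (0 : I)) = 0 := by rw [unitInterval.volume_Iic]; simp
  rw [Measure.restrict_eq_zero.2 this, integral_zero_measure]

theorem continuous_setIntegral_Iic {g : I → V} (hg : Integrable g volume) :
    Continuous fun t : I => ∫ r in Iic t, g r := by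
  rw [Metric.continuous_iff]
  intro t ε hε
  obtain ⟨δ, hδ, h⟩ := exists_integral_Ioc_norm_lt hg hε
  refine ⟨δ, hδ, fun s hs => ?_⟩
  rw [Subtype.dist_eq, Real.dist_eq, abs_lt] at hs
  rcases le_total s t with hst | hst
  · rw [dist_comm, dist_eq_norm, setIntegral_Iic_sub hg hst]
    exact (norm_integral_le_integral_norm _).trans_lt (h s t (by linarith))
  · rw [dist_eq_norm, setIntegral_Iic_sub hg hst]
    exact (norm_integral_le_integral_norm _).trans_lt (h t s (by linarith))

theorem sum_setIntegral_Ioc {g : I → V} (hg : Integrable g volume) {p : ℕ → I} (hp : Monotone p)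
    (N : ℕ) : ∑ j ∈ Finset.range N, ∫ r in Ioc (p j) (p (j + 1)), g r
      = ∫ r in Ioc (p 0) (p N), g r := by
  rw [← setIntegral_Iic_sub hg (hp (Nat.zero_le N)), 
    ← Finset.sum_range_sub (fun j => ∫ r in Iic (p j), g r)]
  exact Finset.sum_congr rfl fun j _ => (setIntegral_Iic_sub hg (hp j.le_succ)).symm

end Integrals

/-! ### Existence of pointwise flows -/

section Existence

/-- Splits an integrable Lipschitz constant into a bounded part, which an exponential weight
absorbs, and a remainder of small integral. -/
theorem exists_integral_truncation_le {b : I → ℝ} (hb : Integrable b volume) {ε : ℝ}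
    (hε : 0 < ε) : ∃ K : ℝ, 0 < K ∧ ∫ s, max (b s - K) 0 ≤ ε := by
  have h : Tendsto (fun k : ℕ => ∫ s, max (b s - k) 0) atTop (𝓝 (∫ _ : I, (0 : ℝ))) := by
    refine tendsto_integral_of_dominated_convergence (fun s => ‖b s‖) (fun k => ?_) hb.norm
      (fun k => Eventually.of_forall fun s => ?_) (Eventually.of_forall fun s => ?_)
    · exact (((hb.sub (integrable_const _)).sup (integrable_const (0 : ℝ)))).1
    · rw [Real.norm_of_nonneg (le_max_right _ _)]
      refine max_le ?_ (norm_nonneg _)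
      have := le_abs_self (b s)
      have : (0 : ℝ) ≤ k := k.cast_nonneg
      rw [Real.norm_eq_abs]
      linarith
    · obtain ⟨k, hk⟩ := exists_nat_ge (b s)
      refine tendsto_const_nhds.congr' ?_
      filter_upwards [eventually_ge_atTop k] with j hj
      have : (k : ℝ) ≤ j := by exact_mod_cast hj
      rw [max_eq_right (by linarith)]
  rw [integral_zero] at h
  obtain ⟨k, hk, hk1⟩ := ((h.eventually (gt_mem_nhds hε)).and (eventually_ge_atTop 1)).exists
  exact ⟨k, by exact_mod_cast hk1, hk.le⟩

theorem mul_setIntegral_exp_le {K : ℝ} (t : I) :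
    K * ∫ s in Iic t, Real.exp (K * (s : ℝ)) ≤ Real.exp (K * (t : ℝ)) := by
  have h1 : ∫ s in Iic t, Real.exp (K * (s : ℝ)) = ∫ s in (0 : ℝ)..t, Real.exp (K * s) := by
    have h2 : (Iic t : Set I) = Subtype.val ⁻¹' (Iic (t : ℝ)) := by ext; simp
    rw [h2, unitInterval.measurePreserving_coe.setIntegral_preimage_emb
      unitInterval.measurableEmbedding_coe (fun s => Real.exp (K * s)),
      Measure.restrict_restrict measurableSet_Iic, intervalIntegral.integral_of_le t.2.1,
      ← integral_Icc_eq_integral_Ioc]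
    congr 2
    ext x
    simp only [mem_inter_iff, mem_Iic, mem_Icc]
    have := t.2.2
    constructor
    · rintro ⟨h1, h2, h3⟩
      exact ⟨h2, h1⟩
    · rintro ⟨h1, h2⟩
      exact ⟨h2, h1, by linarith⟩
  have h3 : ∫ s in (0 : ℝ)..t, K * Real.exp (K * s) = Real.exp (K * t) - Real.exp (K * 0) := by
    refine intervalIntegral.integral_eq_sub_of_hasDerivAt (f := fun s => Real.exp (K * s))
      (fun s _ => ?_) (Continuous.intervalIntegrable (by fun_prop) _ _)
    simpa [mul_comm] using ((hasDerivAt_id s).const_mul K).exp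
  rw [h1, ← intervalIntegral.integral_const_mul, h3]
  linarith [Real.exp_pos (K * 0)]

variable {E : Type*} [NormedAddCommGroup E] [NormedSpace ℝ E] [CompleteSpace E]

/-- Carathéodory solutions of ordinary differential equations exist if the right hand side is
bounded and Lipschitz with an integrable constant. -/
theorem exists_integral_curve {v : I → E → E} {b : I → ℝ} (hb : Integrable b volume)
    (hm : ∀ y : C(I, E), AEStronglyMeasurable (fun s => v s (y s)) volume)
    (h0 : ∀ s x, ‖v s x‖ ≤ b s) (hL : ∀ s x y, ‖v s x - v s y‖ ≤ b s * ‖x - y‖) (x : E) :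
    ∃ y : C(I, E), ∀ t, y t = x + ∫ s in Iic t, v s (y s) := by
  obtain ⟨K, hK, hKb⟩ := exists_integral_truncation_le hb (ε := 1 / 4) (by norm_num)
  have hint : ∀ y : C(I, E), Integrable (fun s => v s (y s)) volume := fun y =>
    hb.mono' (hm y) (Eventually.of_forall fun s => h0 s _)
  -- Substituting `y = w • z` turns the sup norm of `z` into an exponentially weighted norm of `y`.
  -- The bounded part of `b` and the remainder each contribute at most `1 / 4` to the contraction
  -- constant `1 / 2`.
  let w : C(I, ℝ) := ⟨fun t => Real.exp (4 * K * (t : ℝ)), by fun_prop⟩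
  have hw : ∀ t, 0 < w t := fun t => Real.exp_pos _
  have hwmono : ∀ s t : I, s ≤ t → w s ≤ w t := fun s t hst =>
    Real.exp_le_exp.2 (by gcongr)
  let S : C(I, E) → C(I, E) := fun z =>
    ⟨fun t => (w t)⁻¹ • (x + ∫ s in Iic t, v s (w s • z s)), by
      have h1 := continuous_setIntegral_Iic (hint (w • z))
      exact (w.continuous.inv₀ fun t => (hw t).ne').smul (continuous_const.add h1)⟩
  have hS : ContractingWith (1 / 2 : ℝ≥0) S := by
    refine ⟨by norm_num [← NNReal.coe_lt_coe], LipschitzWith.of_dist_le_mul fun z z' => ?_⟩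
    rw [ContinuousMap.dist_le (by positivity)]
    intro t
    set D := dist z z' with hD
    have hD0 : 0 ≤ D := dist_nonneg
    have hpt : ∀ s ∈ Iic t, ‖v s (w s • z s) - v s (w s • z' s)‖
        ≤ D * (K * Real.exp (4 * K * (s : ℝ)) + w t * max (b s - K) 0) := by
      intro s hs
      have hbs : 0 ≤ b s := (norm_nonneg _).trans (h0 s 0)
      have h1 : ‖z s - z' s‖ ≤ D := by
        rw [← dist_eq_norm]; exact ContinuousMap.dist_apply_le_dist s
      have h2 : b s ≤ K + max (b s - K) 0 := by linarith [le_max_left (b s - K) 0]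
      calc _ ≤ b s * ‖w s • z s - w s • z' s‖ := hL _ _ _
        _ = b s * w s * ‖z s - z' s‖ := by
            rw [← smul_sub, norm_smul, Real.norm_of_nonneg (hw s).le, mul_assoc]
        _ ≤ (K + max (b s - K) 0) * w s * D := by
            have := (hw s).le
            gcongr
        _ = D * (K * w s + w s * max (b s - K) 0) := by ring
        _ ≤ D * (K * w s + w t * max (b s - K) 0) := by
            gcongr
            exact hwmono s t hs
    have hi1 : Integrable (fun s : I => max (b s - K) 0) volume :=
      (hb.sub (integrable_const _)).sup (integrable_const (0 : ℝ))
    have hi2 : Integrable (fun s : I => Real.exp (4 * K * (s : ℝ))) volume :=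
      Continuous.integrable_of_hasCompactSupport (by fun_prop) (HasCompactSupport.of_compactSpace _)
    rw [dist_eq_norm]
    change ‖(w t)⁻¹ • (x + ∫ s in Iic t, v s (w s • z s))
      - (w t)⁻¹ • (x + ∫ s in Iic t, v s (w s • z' s))‖ ≤ _
    rw [← smul_sub, add_sub_add_left_eq_sub, norm_smul, norm_inv, Real.norm_of_nonneg (hw t).le,
      inv_mul_le_iff₀ (hw t), ← integral_sub (f := fun s => v s (w s • z s))
        (g := fun s => v s (w s • z' s)) (hint (w • z)).integrableOn (hint (w • z')).integrableOn]
    calc _ ≤ ∫ s in Iic t, D * (K * Real.exp (4 * K * (s : ℝ)) + w t * max (b s - K) 0) := by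
          refine norm_integral_le_of_norm_le (Integrable.integrableOn ?_) ?_
          · exact ((hi2.const_mul K).add (hi1.const_mul (w t))).const_mul D
          · exact (ae_restrict_iff' measurableSet_Iic).2 (Eventually.of_forall hpt)
      _ = D * (K * (∫ s in Iic t, Real.exp (4 * K * (s : ℝ)))
            + w t * ∫ s in Iic t, max (b s - K) 0) := by
          rw [integral_const_mul, integral_add (hi2.const_mul K).integrableOn
            (hi1.const_mul (w t)).integrableOn, integral_const_mul, integral_const_mul]
      _ ≤ D * (1 / 4 * w t + w t * (1 / 4)) := by
          have h1 := mul_setIntegral_exp_le (K := 4 * K) t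
          have h2 : ∫ s in Iic t, max (b s - K) 0 ≤ 1 / 4 := (setIntegral_le_integral hi1
            (Eventually.of_forall fun s => le_max_right _ _)).trans hKb
          have h3 := (hw t).le
          have h4 : K * (∫ s in Iic t, Real.exp (4 * K * (s : ℝ))) ≤ 1 / 4 * w t := by
            change _ ≤ 1 / 4 * Real.exp (4 * K * (t : ℝ))
            linarith
          gcongr
      _ = _ := by
          push_cast
          ring
  obtain ⟨z, hz, -⟩ := hS.exists_fixedPoint 0 (edist_ne_top _ _)
  refine ⟨w • z, fun t => ?_⟩
  have h1 : (S z) t = z t := congrArg (fun f : C(I, E) => f t) hz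
  change (w t)⁻¹ • (x + ∫ s in Iic t, v s (w s • z s)) = z t at h1
  change w t • z t = x + ∫ s in Iic t, v s (w s • z s)
  rw [← h1, smul_inv_smul₀ (hw t).ne']

end Existence

end HolderFlow

namespace HolderFlow

/-! ### Flows of integrable `C^{n,α}_0`-vector fields -/

/-- `Φ t x = x + ∫_0^t u s (Φ s x) ds` for a time-dependent vector field `u`. -/
def IsFlow {d : ℕ} (u Φ : I → Space d → Space d) : Prop :=
  ∀ x : Space d, Integrable (fun s : I => u s (Φ s x)) volume ∧
    ∀ t : I, Φ t x = x + ∫ s in Iic t, u s (Φ s x)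

/-- The points `t j / N` of the uniform partition of `[0,t]`, constant for `j ≥ N`. -/
noncomputable def partitionPoint (t : I) (N j : ℕ) : I :=
  t * ⟨min ((j : ℝ) / N) 1, le_min (by positivity) zero_le_one, min_le_right _ _⟩

theorem partitionPoint_coe (t : I) (N j : ℕ) :
    (partitionPoint t N j : ℝ) = t * min ((j : ℝ) / N) 1 := rfl

theorem partitionPoint_monotone (t : I) (N : ℕ) : Monotone (partitionPoint t N) := by
  intro i j hij
  rw [← Subtype.coe_le_coe, partitionPoint_coe, partitionPoint_coe]
  have := t.2.1
  gcongr

theorem partitionPoint_zero (t : I) (N : ℕ) : partitionPoint t N 0 = 0 := by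
  apply Subtype.ext
  simp [partitionPoint_coe]

theorem partitionPoint_self (t : I) {N : ℕ} (hN : N ≠ 0) : partitionPoint t N N = t := by
  apply Subtype.ext
  have : (N : ℝ) ≠ 0 := by exact_mod_cast hN
  simp [partitionPoint_coe, this]

theorem partitionPoint_succ_sub_le (t : I) (N j : ℕ) :
    (partitionPoint t N (j + 1) : ℝ) - partitionPoint t N j ≤ 1 / N := by
  rw [partitionPoint_coe, partitionPoint_coe, ← mul_sub]
  have h0 := t.2.1
  have h1 := t.2.2
  have h2 : (0 : ℝ) ≤ 1 / N := by positivity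
  have h3 : min (((j + 1 : ℕ) : ℝ) / N) 1 - min ((j : ℝ) / N) 1 ≤ 1 / N := by
    have h4 : ((j + 1 : ℕ) : ℝ) / N = (j : ℝ) / N + 1 / N := by push_cast; ring
    rw [h4]
    rcases le_total ((j : ℝ) / N) 1 with h | h
    · rw [min_eq_left h]
      linarith [min_le_left ((j : ℝ) / N + 1 / N) 1]
    · rw [min_eq_right h]
      linarith [min_le_right ((j : ℝ) / N + 1 / N) 1]
  calc _ ≤ (t : ℝ) * (1 / N) := by gcongr
    _ ≤ 1 * (1 / N) := by gcongr
    _ = _ := one_mul _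

section Flow

variable {d k : ℕ} {α : ℝ}

theorem exists_isFlow (hα : α ∈ Ioc (0 : ℝ) 1) {u : I → C0Holder (k + 1) α d}
    (hu : Integrable u volume) : ∃ Φ, IsFlow (fun s => u s) Φ := by
  have hm : ∀ y : C(I, Space d), AEStronglyMeasurable (fun s => u s (y s)) volume := fun y =>
    (C0Holder.continuous_uncurry hα.1).comp_aestronglyMeasurable
      (hu.1.prodMk y.continuous.aestronglyMeasurable)
  have h : ∀ x, ∃ y : C(I, Space d), ∀ t, y t = x + ∫ s in Iic t, u s (y s) := fun x =>
    exists_integral_curve (v := fun s => u s) hu.norm hm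
      (fun s x => (u s).norm_apply_le hα.1 x) (fun s x y => (u s).norm_sub_apply_le hα.1 x y) x
  choose y hy using h
  exact ⟨fun t x => y x t, fun x => ⟨hu.norm.mono' (hm _)
    (Eventually.of_forall fun s => (u s).norm_apply_le hα.1 _), hy x⟩⟩

variable {u v : I → C0Holder (k + 1) α d} {Φ Ψ : I → Space d → Space d}

namespace IsFlow

theorem apply_zero (hΦ : IsFlow (fun s => u s) Φ) (x : Space d) : Φ 0 x = x := by
  rw [(hΦ x).2, setIntegral_Iic_zero, add_zero]

theorem sub_eq (hΦ : IsFlow (fun s => u s) Φ) {s t : I} (hst : s ≤ t) (x : Space d) :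
    Φ t x - Φ s x = ∫ r in Ioc s t, u r (Φ r x) := by
  rw [(hΦ x).2 t, (hΦ x).2 s, add_sub_add_left_eq_sub, setIntegral_Iic_sub (hΦ x).1 hst]

theorem norm_sub_le (hα : 0 < α) (hu : Integrable u volume) (hΦ : IsFlow (fun s => u s) Φ)
    {s t : I} (hst : s ≤ t) (x : Space d) : ‖Φ t x - Φ s x‖ ≤ ∫ r in Ioc s t, ‖u r‖ := by
  rw [hΦ.sub_eq hst]
  exact norm_integral_le_of_norm_le hu.norm.integrableOn
    (Eventually.of_forall fun r => (u r).norm_apply_le hα _)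

theorem norm_sub_id_le (hα : 0 < α) (hu : Integrable u volume) (hΦ : IsFlow (fun s => u s) Φ)
    (t : I) (x : Space d) : ‖Φ t x - x‖ ≤ ∫ r, ‖u r‖ := by
  have h := hΦ.norm_sub_le hα hu unitInterval.nonneg' (s := 0) (t := t) x
  rw [hΦ.apply_zero] at h
  exact h.trans (setIntegral_le_integral hu.norm (Eventually.of_forall fun _ => norm_nonneg _))

theorem tendsto_sub_id (hα : 0 < α) (hu : Integrable u volume) (hΦ : IsFlow (fun s => u s) Φ)
    (t : I) : Tendsto (fun x => Φ t x - x) (Bornology.cobounded _) (𝓝 0) := by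
  have h1 : ∀ s, Tendsto (Φ s) (Bornology.cobounded _) (Bornology.cobounded _) := fun s => by
    rw [← tendsto_norm_atTop_iff_cobounded]
    refine tendsto_atTop_mono (f := fun x => ‖x‖ - ∫ r, ‖u r‖) (fun x => ?_)
      (tendsto_atTop_add_const_right _ _ tendsto_norm_cobounded_atTop)
    have h2 := hΦ.norm_sub_id_le hα hu s x
    have h3 : ‖x‖ ≤ ‖Φ s x‖ + ‖Φ s x - x‖ := by
      have := _root_.norm_sub_le (Φ s x) (Φ s x - x)
      rwa [sub_sub_cancel] at this
    linarith
  have : (Bornology.cobounded (Space d)).IsCountablyGenerated := by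
    rw [← comap_norm_atTop]; infer_instance
  have h2 : Tendsto (fun x => ∫ s in Iic t, u s (Φ s x)) (Bornology.cobounded (Space d))
      (𝓝 (∫ s in Iic t, (0 : Space d))) := by
    refine tendsto_integral_filter_of_dominated_convergence (fun s => ‖u s‖)
      (Eventually.of_forall fun x => (hΦ x).1.1.restrict)
      (Eventually.of_forall fun x => Eventually.of_forall fun s => (u s).norm_apply_le hα _)
      hu.norm.integrableOn (Eventually.of_forall fun s => (u s).tendsto_zero.comp (h1 s))
  rw [integral_zero] at h2
  refine h2.congr fun x => ?_
  rw [(hΦ x).2, add_sub_cancel_left]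

end IsFlow

/-- The integral of `u` over a step of the partition. -/
noncomputable def stepField (u : I → C0Holder (k + 1) α d) (t : I) (N j : ℕ) :
    C0Holder (k + 1) α d :=
  ∫ r in Ioc (partitionPoint t N j) (partitionPoint t N (j + 1)), u r

/-- The Euler approximation of the flow of `u` at time `t`, with `N` steps. -/
noncomputable def eulerApprox (u : I → C0Holder (k + 1) α d) (t : I) (N : ℕ) : Space d → Space d :=
  eulerMap (fun j => stepField u t N j) N

theorem stepField_apply (hα : α ∈ Ioc (0 : ℝ) 1) (hu : Integrable u volume) (t : I) (N j : ℕ)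
    (x : Space d) : stepField u t N j x
      = ∫ r in Ioc (partitionPoint t N j) (partitionPoint t N (j + 1)), u r x := by
  have := C0Holder.completeSpace (n := k + 1) (d := d) hα
  exact ((C0Holder.eval hα.1 x).integral_comp_comm hu.integrableOn).symm

theorem norm_stepField_le (t : I) (N j : ℕ) : ‖stepField u t N j‖
    ≤ ∫ r in Ioc (partitionPoint t N j) (partitionPoint t N (j + 1)), ‖u r‖ :=
  norm_integral_le_integral_norm _

theorem holderBound_stepField (hα : 0 < α) (t : I) (N j : ℕ) : HolderBound (k + 1) α
    (∫ r in Ioc (partitionPoint t N j) (partitionPoint t N (j + 1)), ‖u r‖) (stepField u t N j) :=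
  ((stepField u t N j).holderBound hα).mono (norm_stepField_le t N j)

theorem sum_integral_partition_le {V : Type*} [NormedAddCommGroup V] {g : I → V}
    (hg : Integrable g volume) (t : I) (N : ℕ) : ∑ j ∈ Finset.range N,
      ∫ r in Ioc (partitionPoint t N j) (partitionPoint t N (j + 1)), ‖g r‖ ≤ ∫ r, ‖g r‖ := by
  rw [sum_setIntegral_Ioc hg.norm (partitionPoint_monotone t N)]
  exact setIntegral_le_integral hg.norm (Eventually.of_forall fun _ => norm_nonneg _)

theorem exists_forall_integral_partition_lt {V : Type*} [NormedAddCommGroup V] {g : I → V}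
    (hg : Integrable g volume) {ε : ℝ} (hε : 0 < ε) : ∀ᶠ N : ℕ in atTop, ∀ (t : I) (j : ℕ),
      ∀ r ≤ partitionPoint t N (j + 1), ∫ s in Ioc (partitionPoint t N j) r, ‖g s‖ < ε := by
  obtain ⟨δ, hδ, h⟩ := exists_integral_Ioc_norm_lt hg hε
  have h1 : ∀ᶠ N : ℕ in atTop, 1 / (N : ℝ) < δ :=
    tendsto_one_div_atTop_nhds_zero_nat.eventually (gt_mem_nhds hδ)
  filter_upwards [h1] with N hN t j r hr
  refine h _ _ ?_
  have h2 := partitionPoint_succ_sub_le t N j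
  have h3 : (r : ℝ) ≤ partitionPoint t N (j + 1) := hr
  linarith

/-- Consistency of the scheme: within one step an orbit moves by at most `η`, and `u r` is Lipschitz
with constant `‖u r‖`. -/
theorem IsFlow.norm_sub_stepField_le (hα : α ∈ Ioc (0 : ℝ) 1) (hu : Integrable u volume)
    (hΦ : IsFlow (fun s => u s) Φ) {t : I} {N j : ℕ} {η : ℝ}
    (hη : ∀ r ≤ partitionPoint t N (j + 1), ∫ s in Ioc (partitionPoint t N j) r, ‖u s‖ ≤ η)
    (x : Space d) :
    ‖Φ (partitionPoint t N (j + 1)) x - Φ (partitionPoint t N j) x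
        - stepField u t N j (Φ (partitionPoint t N j) x)‖
      ≤ η * ∫ r in Ioc (partitionPoint t N j) (partitionPoint t N (j + 1)), ‖u r‖ := by
  have hi : Integrable (fun r => u r (Φ (partitionPoint t N j) x)) volume :=
    (C0Holder.eval hα.1 (Φ (partitionPoint t N j) x)).integrable_comp hu
  rw [hΦ.sub_eq (partitionPoint_monotone t N j.le_succ), stepField_apply hα hu,
    ← integral_sub (hΦ x).1.integrableOn hi.integrableOn, ← integral_const_mul]
  refine norm_integral_le_of_norm_le (hu.norm.const_mul η).integrableOn
    ((ae_restrict_iff' measurableSet_Ioc).2 (Eventually.of_forall fun r hr => ?_))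
  refine ((u r).norm_sub_apply_le hα.1 _ _).trans ?_
  rw [mul_comm]
  gcongr
  exact (hΦ.norm_sub_le hα.1 hu hr.1.le x).trans (hη r hr.2)

theorem IsFlow.norm_eulerApprox_sub_le (hα : α ∈ Ioc (0 : ℝ) 1) (hu : Integrable u volume)
    (hΦ : IsFlow (fun s => u s) Φ) {t : I} {N : ℕ} (hN : N ≠ 0) {η : ℝ} (hη0 : 0 ≤ η)
    (hη : ∀ j, ∀ r ≤ partitionPoint t N (j + 1),
      ∫ s in Ioc (partitionPoint t N j) r, ‖u s‖ ≤ η) (x : Space d) :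
    ‖eulerApprox u t N x - Φ t x‖ ≤ Real.exp (∫ r, ‖u r‖) * (η * ∫ r, ‖u r‖) := by
  have h1 := norm_eulerMap_sub_le (f := fun j => stepField u t N j)
    (z := fun j => Φ (partitionPoint t N j) x)
    (fun j => (holderBound_stepField (u := u) hα.1 t N j).nonneg)
    (fun j => (holderBound_stepField hα.1 t N j).norm_sub_le)
    (fun j => hΦ.norm_sub_stepField_le hα hu (hη j) x) N
  rw [partitionPoint_zero, partitionPoint_self t hN, hΦ.apply_zero, ← Finset.mul_sum] at h1
  have h2 := sum_integral_partition_le hu t N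
  have h3 : 0 ≤ ∫ r, ‖u r‖ := integral_nonneg fun _ => norm_nonneg _
  refine h1.trans ?_
  gcongr

/-- The Euler approximations converge to every flow. -/
theorem IsFlow.tendstoUniformly_eulerApprox (hα : α ∈ Ioc (0 : ℝ) 1) (hu : Integrable u volume)
    (hΦ : IsFlow (fun s => u s) Φ) (t : I) :
    TendstoUniformly (eulerApprox u t) (Φ t) atTop := by
  rw [Metric.tendstoUniformly_iff]
  intro ε hε
  obtain ⟨R, hR⟩ : ∃ R, R = ∫ r, ‖u r‖ := ⟨_, rfl⟩
  have hR0 : 0 ≤ R := hR ▸ integral_nonneg fun _ => norm_nonneg _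
  have hη0 : 0 < ε / (Real.exp R * (R + 1)) := by positivity
  filter_upwards [exists_forall_integral_partition_lt hu hη0, eventually_ne_atTop 0] with N hN hN0 x
  have h1 := hΦ.norm_eulerApprox_sub_le hα hu hN0 hη0.le (fun j r hr => (hN t j r hr).le) x
  rw [dist_comm, dist_eq_norm]
  refine h1.trans_lt ?_
  rw [← hR]
  have h2 : Real.exp R * (ε / (Real.exp R * (R + 1)) * R) = ε * (R / (R + 1)) := by
    field_simp
  rw [h2]
  exact mul_lt_of_lt_one_right hε ((div_lt_one (by linarith)).2 (by linarith))

/-- The Euler approximations depend on `u` alone and converge to any flow of `u`. -/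
theorem IsFlow.eq_of_isFlow (hα : α ∈ Ioc (0 : ℝ) 1) (hu : Integrable u volume)
    (hΦ : IsFlow (fun s => u s) Φ) (hΨ : IsFlow (fun s => u s) Ψ) (t : I) (x : Space d) :
    Φ t x = Ψ t x :=
  tendsto_nhds_unique ((hΦ.tendstoUniformly_eulerApprox hα hu t).tendsto_at x)
    ((hΨ.tendstoUniformly_eulerApprox hα hu t).tendsto_at x)

/-- Flows are uniformly bounded in `Id + C^{n,α}`. -/
theorem exists_holderBound_flow (hα : α ∈ Ioc (0 : ℝ) 1) (k d : ℕ) {R : ℝ} (hR : 0 ≤ R) :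
    ∃ C : ℝ, 0 ≤ C ∧ ∀ (u : I → C0Holder (k + 1) α d) (Φ : I → Space d → Space d),
      Integrable u volume → ∫ r, ‖u r‖ ≤ R → IsFlow (fun s => u s) Φ →
        ∀ t, HolderBound (k + 1) α C (fun x => Φ t x - x) := by
  obtain ⟨C, hC, h⟩ := exists_holderBound_eulerMap (E := Space d) hα k hR
  refine ⟨C, hC, fun u Φ hu huR hΦ t => ?_⟩
  refine HolderBound.of_tendstoUniformly (f := fun N x => eulerApprox u t N x - x) hα
    (fun N => h _ _ N (holderBound_stepField hα.1 t N)
      ((sum_integral_partition_le hu t N).trans huR)) ?_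
  have h1 := hΦ.tendstoUniformly_eulerApprox hα hu t
  rw [Metric.tendstoUniformly_iff] at h1 ⊢
  simpa only [dist_sub_right] using h1

/-- Flows depend Lipschitz continuously in `C^0` on the vector field. -/
theorem IsFlow.norm_sub_flow_le (hα : α ∈ Ioc (0 : ℝ) 1) (hu : Integrable u volume)
    (hv : Integrable v volume) (hΦ : IsFlow (fun s => u s) Φ) (hΨ : IsFlow (fun s => v s) Ψ)
    (t : I) (x : Space d) :
    ‖Φ t x - Ψ t x‖ ≤ Real.exp (∫ r, ‖u r‖) * ∫ r, ‖u r - v r‖ := by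
  have h1 := (hΦ.tendstoUniformly_eulerApprox hα hu t).tendsto_at x
  have h2 := (hΨ.tendstoUniformly_eulerApprox hα hv t).tendsto_at x
  refine le_of_tendsto (h1.sub h2).norm (Eventually.of_forall fun N => ?_)
  -- The Euler orbit of `v` is treated as an approximate orbit of the scheme for `u`; its defect in
  -- each step is the difference of the two step fields.
  have h3 := norm_eulerMap_sub_le (f := fun j => stepField u t N j)
    (z := fun j => eulerMap (fun j => stepField v t N j) j x)
    (c := fun j => ∫ r in Ioc (partitionPoint t N j) (partitionPoint t N (j + 1)), ‖u r - v r‖)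
    (fun j => (holderBound_stepField (u := u) hα.1 t N j).nonneg)
    (fun j => (holderBound_stepField hα.1 t N j).norm_sub_le) (fun j => ?_) N
  · refine h3.trans ?_
    have h4 := sum_integral_partition_le hu t N
    have h5 := sum_integral_partition_le (hu.sub hv) t N
    have h6 : 0 ≤ ∫ r, ‖u r - v r‖ := integral_nonneg fun _ => norm_nonneg _
    gcongr
    exact h5
  · simp only [eulerMap, add_sub_cancel_left]
    rw [norm_sub_rev, ← C0Holder.sub_apply]
    refine (C0Holder.norm_apply_le hα.1 _ _).trans ?_
    rw [stepField, stepField, ← integral_sub hu.integrableOn hv.integrableOn]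
    exact norm_integral_le_integral_norm _

/-- Limit of the lower bounds for Euler maps, whose steps are below `1 / 2` once the partition is
fine. It makes the differential of the flow injective. -/
theorem IsFlow.le_norm_sub (hα : α ∈ Ioc (0 : ℝ) 1) (hu : Integrable u volume)
    (hΦ : IsFlow (fun s => u s) Φ) (t : I) (x y : Space d) :
    Real.exp (-2 * ∫ r, ‖u r‖) * ‖x - y‖ ≤ ‖Φ t x - Φ t y‖ := by
  have h1 := hΦ.tendstoUniformly_eulerApprox hα hu t
  refine ge_of_tendsto ((h1.tendsto_at x).sub (h1.tendsto_at y)).norm ?_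
  filter_upwards [exists_forall_integral_partition_lt hu (ε := 1 / 2) (by norm_num)] with N hN
  refine le_trans ?_ (le_norm_eulerMap_sub (fun j =>
    ⟨(holderBound_stepField (u := u) hα.1 t N j).nonneg, (hN t j _ le_rfl).le⟩)
    (fun j => (holderBound_stepField hα.1 t N j).norm_sub_le) N x y)
  have h4 := sum_integral_partition_le hu t N
  exact mul_le_mul_of_nonneg_right (Real.exp_le_exp.2 (by linarith)) (norm_nonneg _)

/-- Uniformly bounded families in `C^{n,α}` that are small in `C^0` are small in `C^{n,α'}`. -/
theorem HolderBound.exists_small {α' C η : ℝ} (hα : α ∈ Ioc (0 : ℝ) 1) (hα' : α' ∈ Ioo 0 α)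
    (n : ℕ) (hC : 0 ≤ C) (hη : 0 < η) : ∃ ε > 0, ∀ g : Space d → Space d,
      HolderBound n α C g → (∀ x, ‖g x‖ ≤ ε) → HolderBound n α' η g := by
  obtain ⟨A, γ, hA, hγ, -, h⟩ := HolderBound.exists_interpolation (E := Space d) hα hα' n C 1 hC
    one_pos
  obtain ⟨ε, ⟨hε0, hε1⟩, hε⟩ := exists_mul_rpow_lt A hγ hη
  exact ⟨ε, hε0, fun g hg hgε => (h _ g ε hε0 hε1 hg hgε).mono hε.le⟩

/-- The curve `t ↦ Φ t - id` is continuous with respect to weaker Hölder norms. -/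
theorem IsFlow.exists_holderBound_sub {α' η : ℝ} (hα : α ∈ Ioc (0 : ℝ) 1) (hα' : α' ∈ Ioo 0 α)
    (hu : Integrable u volume) (hΦ : IsFlow (fun s => u s) Φ) (hη : 0 < η) :
    ∃ δ > 0, ∀ s t : I, dist s t < δ →
      HolderBound (k + 1) α' η (fun x => (Φ s x - x) - (Φ t x - x)) := by
  obtain ⟨C, hC, h⟩ := exists_holderBound_flow hα k d (R := ∫ r, ‖u r‖)
    (integral_nonneg fun _ => norm_nonneg _)
  obtain ⟨ε, hε, hs⟩ := HolderBound.exists_small (d := d) hα hα' (k + 1)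
    (add_nonneg hC hC) hη
  obtain ⟨δ, hδ, hI⟩ := exists_integral_Ioc_norm_lt hu hε
  refine ⟨δ, hδ, fun s t hst => hs _ ((h u Φ hu le_rfl hΦ s).sub (h u Φ hu le_rfl hΦ t))
    fun x => ?_⟩
  rw [Subtype.dist_eq, Real.dist_eq, abs_lt] at hst
  rw [sub_sub_sub_cancel_right]
  rcases le_total s t with hle | hle
  · rw [norm_sub_rev]
    exact (hΦ.norm_sub_le hα.1 hu hle x).trans (hI s t (by linarith)).le
  · exact (hΦ.norm_sub_le hα.1 hu hle x).trans (hI t s (by linarith)).le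

theorem IsFlow.differentiable (hα : α ∈ Ioc (0 : ℝ) 1) (hu : Integrable u volume)
    (hΦ : IsFlow (fun s => u s) Φ) (t : I) : Differentiable ℝ (Φ t) := by
  obtain ⟨C, hC, h⟩ := exists_holderBound_flow hα k d (R := ∫ r, ‖u r‖)
    (integral_nonneg fun _ => norm_nonneg _)
  simpa using (h u Φ hu le_rfl hΦ t).differentiable.add differentiable_id

/-- The differential of a map with a lower Lipschitz bound has nonzero determinant. -/
theorem det_fderiv_ne_zero {f : Space d → Space d} {c : ℝ} (hc : 0 < c) {x : Space d}
    (hf : DifferentiableAt ℝ f x) (h : ∀ y, c * ‖y - x‖ ≤ ‖f y - f x‖) :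
    (fderiv ℝ f x).det ≠ 0 := by
  intro h0
  obtain ⟨v, hv, hv0⟩ := (Submodule.ne_bot_iff _).1 (LinearMap.bot_lt_ker_of_det_eq_zero h0).ne'
  have hv' : fderiv ℝ f x v = 0 := hv
  have h1 : HasDerivAt (fun t : ℝ => f (x + t • v)) (fderiv ℝ f x v) 0 := by
    have h2 : HasFDerivAt f (fderiv ℝ f x) (x + (0 : ℝ) • v) := by simpa using hf.hasFDerivAt
    have h3 : HasDerivAt (fun t : ℝ => x + t • v) v 0 := by
      simpa using ((hasDerivAt_id (0 : ℝ)).smul_const v).const_add x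
    exact h2.comp_hasDerivAt 0 h3
  have h4 := (hasDerivAt_iff_tendsto_slope_zero.1 h1).norm
  rw [hv', norm_zero] at h4
  have h5 : c * ‖v‖ ≤ 0 := by
    refine ge_of_tendsto h4 (eventually_mem_nhdsWithin.mono fun t ht => ?_)
    have ht' : t ≠ 0 := ht
    have h6 := h (x + t • v)
    rw [add_sub_cancel_left, norm_smul] at h6
    have h7 : 0 < ‖t‖ := norm_pos_iff.2 ht'
    rw [zero_add, zero_smul, add_zero, norm_smul, norm_inv, inv_mul_eq_div, le_div_iff₀ h7]
    linarith
  have : 0 < ‖v‖ := norm_pos_iff.2 hv0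
  nlinarith

/-- The determinant is continuous in time, never zero, and `1` at time `0`, so the intermediate
value theorem fixes its sign. -/
theorem IsFlow.det_pos (hα : α ∈ Ioc (0 : ℝ) 1) (hu : Integrable u volume)
    (hΦ : IsFlow (fun s => u s) Φ) (t : I) (x : Space d) : 0 < (fderiv ℝ (Φ t) x).det := by
  have hne : ∀ s, (fderiv ℝ (Φ s) x).det ≠ 0 := fun s =>
    det_fderiv_ne_zero (Real.exp_pos _) (hΦ.differentiable hα hu s x)
      fun y => hΦ.le_norm_sub hα hu s y x
  have hcont : Continuous fun s => fderiv ℝ (Φ s) x := by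
    rw [Metric.continuous_iff]
    intro s ε hε
    have hα2 : α / 2 ∈ Ioo 0 α := ⟨half_pos hα.1, half_lt_self hα.1⟩
    obtain ⟨δ, hδ, h⟩ := hΦ.exists_holderBound_sub hα hα2 hu (half_pos hε)
    refine ⟨δ, hδ, fun r hr => ?_⟩
    have h1 := (h r s hr).fderiv.norm_le x
    simp only [sub_sub_sub_cancel_right] at h1
    rw [fderiv_fun_sub (hΦ.differentiable hα hu r x) (hΦ.differentiable hα hu s x)] at h1
    rw [dist_eq_norm]
    exact h1.trans_lt (half_lt_self hε)
  have hdet : Continuous fun s => (fderiv ℝ (Φ s) x).det :=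
    ContinuousLinearMap.continuous_det.comp hcont
  have h0 : (fderiv ℝ (Φ 0) x).det = 1 := by
    have : Φ 0 = fun x => x := funext hΦ.apply_zero
    rw [this, fderiv_fun_id]
    exact LinearMap.det_id
  by_contra hneg
  obtain ⟨s, hs⟩ := mem_range_of_exists_le_of_exists_ge hdet ⟨t, not_lt.1 hneg⟩
    ⟨0, zero_le_one.trans h0.ge⟩
  exact hne s hs

end Flow

end HolderFlow

namespace HolderFlow

/-! ### The flow map -/

section FlowMap

variable {n k d : ℕ} {β : ℝ}

theorem mem_Ioc_of_mem_Ioo (hβ : β ∈ Ioc (0 : ℝ) 1) (α : Ioo (0 : ℝ) β) :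
    (α : ℝ) ∈ Ioc (0 : ℝ) 1 := ⟨α.2.1, α.2.2.le.trans hβ.2⟩

/-- The room above `α` that pays for the loss of exponent in every interpolation. -/
theorem exists_between_Ioo (α : Ioo (0 : ℝ) β) :
    ∃ α' : Ioo (0 : ℝ) β, (α : ℝ) ∈ Ioo 0 (α' : ℝ) := by
  obtain ⟨a, h1, h2⟩ := exists_between α.2.2
  exact ⟨⟨a, α.2.1.trans h1, h2⟩, α.2.1, h1⟩

theorem L1Minus.continuous_toL1 (α : Ioo (0 : ℝ) β) :
    Continuous (L1Minus.toL1 (n := n) (d := d) α) :=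
  continuous_iInf_dom continuous_induced_dom

theorem continuous_diffMinus_iff {X : Type*} [TopologicalSpace X] {f : X → DiffMinus n β d} :
    Continuous f ↔ ∀ α, Continuous fun x => C0HolderMinus.incl α (f x).chart := by
  refine continuous_induced_rng.trans (continuous_iInf_rng.trans (forall_congr' fun α => ?_))
  exact continuous_induced_rng

/-- The inclusions do not change values, so one and the same map is a flow for every exponent. -/
theorem IsPointwiseFlow.isFlow {u : strongFields n β d} {Φ : I → Space d → Space d}
    (h : IsPointwiseFlow u.1 Φ) (α : Ioo (0 : ℝ) β) :
    IsFlow (fun s => C0HolderMinus.incl α (u.1 s)) Φ := h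

theorem IsPointwiseFlow.congr {u v : I → C0HolderMinus n β d} {Φ : I → Space d → Space d}
    (h : IsPointwiseFlow u Φ) (huv : ∀ᵐ s ∂(volume : Measure I), u s = v s) :
    IsPointwiseFlow v Φ := by
  intro x
  have h1 : ∀ᵐ s ∂(volume : Measure I), u s (Φ s x) = v s (Φ s x) := by
    filter_upwards [huv] with s hs
    rw [hs]
  refine ⟨(h x).1.congr h1, fun t => ?_⟩
  rw [(h x).2, integral_congr_ae (ae_restrict_of_ae h1)]

/-- The flow is built for the single exponent `β / 2`. It is then a flow for each `α < β`, which
gives membership in every `C^{n,α}_0`; continuity in time for `α` uses a larger exponent `α'`. -/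
theorem exists_pointwiseFlow (hβ : β ∈ Ioc (0 : ℝ) 1) (u : strongFields (k + 1) β d) :
    ∃ φ : C(I, DiffMinus (k + 1) β d), IsPointwiseFlow u.1 fun t => φ t := by
  let α₀ : Ioo (0 : ℝ) β := ⟨β / 2, half_pos hβ.1, half_lt_self hβ.1⟩
  obtain ⟨Φ, hΦ⟩ := exists_isFlow (mem_Ioc_of_mem_Ioo hβ α₀) (u.2 α₀)
  have hΦ' : IsPointwiseFlow u.1 Φ := hΦ
  have hmem : ∀ t, Φ t - id ∈ c0HolderMinusSubmodule (k + 1) β d := fun t => by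
    refine (Submodule.mem_iInf _).2 fun α => ?_
    have hα := mem_Ioc_of_mem_Ioo hβ α
    obtain ⟨C, -, h⟩ := exists_holderBound_flow hα k d
      (R := ∫ r, ‖C0HolderMinus.incl α (u.1 r)‖) (integral_nonneg fun _ => norm_nonneg _)
    exact C0Holder.mem_of_holderBound hα (h _ Φ (u.2 α) le_rfl (hΦ'.isFlow α) t)
      ((hΦ'.isFlow α).tendsto_sub_id hα.1 (u.2 α) t)
  refine ⟨⟨fun t => ⟨Φ t, hmem t,
    fun x => hΦ.det_pos (mem_Ioc_of_mem_Ioo hβ α₀) (u.2 α₀) t x⟩, ?_⟩, hΦ'⟩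
  refine continuous_diffMinus_iff.2 fun α => ?_
  obtain ⟨α', hα'⟩ := exists_between_Ioo α
  rw [Metric.continuous_iff]
  intro t ε hε
  obtain ⟨δ, hδ, h⟩ := (hΦ'.isFlow α').exists_holderBound_sub (mem_Ioc_of_mem_Ioo hβ α') hα'
    (u.2 α') (half_pos hε)
  refine ⟨δ, hδ, fun s hs => ?_⟩
  rw [dist_eq_norm]
  exact (C0Holder.norm_le_of_holderBound α.2.1.le (h s t hs)).trans_lt (half_lt_self hε)

theorem L1Minus.mk_surjective : Function.Surjective (L1Minus.mk (n := n) (β := β) (d := d)) :=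
  Submodule.mkQ_surjective _

theorem L1Minus.norm_toL1_mk (α : Ioo (0 : ℝ) β) (u : strongFields n β d) :
    ‖L1Minus.toL1 α (L1Minus.mk u)‖ = ∫ s, ‖C0HolderMinus.incl α (u.1 s)‖ := by
  rw [integral_norm_eq_lintegral_enorm (u.2 α).1]
  exact (Integrable.norm_toL1_eq_lintegral_enorm _ (u.2 α))

/-- The flow map is Hölder on bounded sets, up to an arbitrarily small loss of regularity. -/
theorem exists_norm_flow_sub_le (hβ : β ∈ Ioc (0 : ℝ) 1) (α : Ioo (0 : ℝ) β) :
    ∃ α' : Ioo (0 : ℝ) β, ∀ R B : ℝ, 0 ≤ R → 0 < B → ∃ C γ : ℝ, 0 ≤ C ∧ 0 < γ ∧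
      ∀ (u v : strongFields (k + 1) β d) (φ ψ : I → DiffMinus (k + 1) β d),
        IsPointwiseFlow u.1 (fun t => φ t) → IsPointwiseFlow v.1 (fun t => ψ t) →
        ‖L1Minus.toL1 α' (L1Minus.mk u)‖ ≤ R → ‖L1Minus.toL1 α' (L1Minus.mk v)‖ ≤ R →
        ∀ ε : ℝ, 0 < ε → ε ≤ B →
          ‖L1Minus.toL1 α' (L1Minus.mk u) - L1Minus.toL1 α' (L1Minus.mk v)‖ ≤ ε →
          ∀ t, ‖C0HolderMinus.incl α (φ t).chart - C0HolderMinus.incl α (ψ t).chart‖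
            ≤ C * ε ^ γ := by
  obtain ⟨α', hα'⟩ := exists_between_Ioo α
  have hα1 := mem_Ioc_of_mem_Ioo hβ α'
  refine ⟨α', fun R B hR hB => ?_⟩
  obtain ⟨M, hM, hflow⟩ := exists_holderBound_flow hα1 k d hR
  -- `M + M` bounds the difference of two flows in `C^{n,α'}`, and `exp R * B` bounds the range of
  -- their sup distances.
  obtain ⟨C, γ, hC, hγ, -, h⟩ := HolderBound.exists_interpolation (E := Space d) hα1 hα' (k + 1)
    (M + M) (Real.exp R * B) (add_nonneg hM hM) (by positivity)
  refine ⟨C * Real.exp R ^ γ, γ, by positivity, hγ,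
    fun u v φ ψ hφ hψ hu hv ε hε hεB huv t => ?_⟩
  rw [← map_sub, ← map_sub, L1Minus.norm_toL1_mk] at huv
  rw [L1Minus.norm_toL1_mk] at hu hv
  have h1 := hflow _ _ (u.2 α') hu (hφ.isFlow α') t
  have h2 := hflow _ _ (v.2 α') hv (hψ.isFlow α') t
  have h3 : ∀ x, ‖(φ t x - x) - (ψ t x - x)‖ ≤ Real.exp R * ε := fun x => by
    rw [sub_sub_sub_cancel_right]
    refine ((hφ.isFlow α').norm_sub_flow_le hα1 (u.2 α') (v.2 α') (hψ.isFlow α') t x).trans ?_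
    have h4 : ∫ r, ‖C0HolderMinus.incl α' (u.1 r) - C0HolderMinus.incl α' (v.1 r)‖ ≤ ε := huv
    gcongr
  have h4 := h (Space d) _ (Real.exp R * ε) (by positivity) (by gcongr) (h1.sub h2) h3
  rw [Real.mul_rpow (Real.exp_nonneg R) hε.le, ← mul_assoc] at h4
  exact C0Holder.norm_le_of_holderBound α.2.1.le h4

/-- Boundedness in `C(I, C^{n,β-}_0)`. -/
theorem isVonNBounded_of_forall_norm_le {S : Set C(I, C0HolderMinus n β d)}
    (h : ∀ α : Ioo (0 : ℝ) β, ∃ D : ℝ, ∀ w ∈ S, ∀ τ, ‖C0HolderMinus.incl α (w τ)‖ ≤ D) :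
    Bornology.IsVonNBounded ℝ S := by
  refine Bornology.isVonNBounded_of_smul_tendsto_zero (ε := fun i : ℕ => 1 / ((i : ℝ) + 1))
    (l := atTop) (Eventually.of_forall fun i => by positivity) fun w hw => ?_
  -- Convergence along the product with `⊤` is convergence uniform in the time variable.
  have key : Tendsto (fun p : ℕ × I => (1 / ((p.1 : ℝ) + 1)) • w p.1 p.2)
      (atTop ×ˢ (⊤ : Filter I)) (𝓝 (0 : C0HolderMinus n β d)) := by
    rw [nhds_iInf, tendsto_iInf]
    intro α
    rw [nhds_induced, tendsto_comap_iff, map_zero, tendsto_zero_iff_norm_tendsto_zero]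
    obtain ⟨D, hD⟩ := h α
    have h1 : Tendsto (fun p : ℕ × I => 1 / ((p.1 : ℝ) + 1) * D) (atTop ×ˢ (⊤ : Filter I))
        (𝓝 (0 * D)) :=
      (tendsto_one_div_add_atTop_nhds_zero_nat.comp tendsto_fst).mul_const D
    rw [zero_mul] at h1
    refine squeeze_zero (fun _ => norm_nonneg _) (fun p => ?_) h1
    rw [Function.comp_apply, map_smul, norm_smul, Real.norm_of_nonneg (by positivity)]
    gcongr
    exact hD _ (hw _) _
  rw [ContinuousMap.tendsto_nhds_compactOpen]
  intro K _ U hU hKU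
  rcases K.eq_empty_or_nonempty with rfl | ⟨τ, hτ⟩
  · exact Eventually.of_forall fun i => mapsTo_empty _ _
  have hU0 : U ∈ 𝓝 (0 : C0HolderMinus n β d) := hU.mem_nhds (hKU hτ)
  have h1 := (key.eventually hU0).curry
  filter_upwards [h1] with i hi s _
  exact (eventually_top.1 hi) s

end FlowMap

/-! ### Smooth curves of fields and slowly vanishing moduli. -/

section Curves

variable {n d : ℕ} {β : ℝ}

/-- A continuous linear map into a normed space turns `c` into a `C^1` curve there, whose derivative
is bounded on compact intervals. -/
theorem IsSmoothCurve.exists_lipschitz {c : ℝ → L1Minus n β d} (hc : IsSmoothCurve c)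
    (α : Ioo (0 : ℝ) β) (a b : ℝ) : ∃ R L : ℝ, 0 ≤ R ∧ 0 < L ∧
      (∀ s ∈ Icc a b, ‖L1Minus.toL1 α (c s)‖ ≤ R) ∧ ∀ s ∈ Icc a b, ∀ t ∈ Icc a b,
        ‖L1Minus.toL1 α (c t) - L1Minus.toL1 α (c s)‖ ≤ L * |t - s| := by
  obtain ⟨D, rfl, hD⟩ := hc
  have hder : ∀ j t, HasDerivAt (fun s => L1Minus.toL1 α (D j s))
      (L1Minus.toL1 α (D (j + 1) t)) t := by
    intro j t
    rw [hasDerivAt_iff_tendsto_slope_zero]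
    refine (((L1Minus.continuous_toL1 α).tendsto _).comp (hD j t)).congr fun h => ?_
    rw [Function.comp_apply, map_smul, map_sub]
  have hcont : ∀ j, Continuous fun s => L1Minus.toL1 α (D j s) := fun j =>
    continuous_iff_continuousAt.2 fun t => (hder j t).continuousAt
  obtain ⟨R, hR⟩ := isCompact_Icc.exists_bound_of_continuousOn (hcont 0).continuousOn (s := Icc a b)
  obtain ⟨L, hL⟩ := isCompact_Icc.exists_bound_of_continuousOn (hcont 1).continuousOn (s := Icc a b)
  refine ⟨max R 0, max L 1, le_max_right _ _, by positivity,
    fun s hs => (hR s hs).trans (le_max_left _ _), fun s hs t ht => ?_⟩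
  exact Convex.norm_image_sub_le_of_norm_hasDerivWithin_le
    (fun r _ => (hder 0 r).hasDerivWithinAt) (fun r hr => (hL r hr).trans (le_max_left _ _))
    (convex_Icc a b) hs ht

/-- Near `0` the comparison is the limes inferior condition; on the rest of `(0, T]` monotonicity
keeps `ω` above `ω δ > 0`. Positivity of `ω r` is recorded because the curve quotients divide by it.
-/
theorem IsSlowlyVanishing.exists_rpow_le {ω : ℝ≥0 → ℝ≥0} (hω : IsSlowlyVanishing ω) {γ : ℝ}
    (hγ : 0 < γ) (T : ℝ≥0) : ∃ A : ℝ, 0 ≤ A ∧ ∀ r : ℝ≥0, 0 < r → r ≤ T →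
      0 < ω r ∧ (r : ℝ) ^ γ ≤ A * ω r := by
  obtain ⟨c, hc0, hc⟩ := ENNReal.lt_iff_exists_nnreal_btwn.1 (hω.liminf_pos γ hγ)
  have hc0' : 0 < c := by exact_mod_cast hc0
  have hev := eventually_lt_of_lt_liminf hc
  obtain ⟨δ, hδ, hδω⟩ := (mem_nhdsGT_iff_exists_Ioc_subset).1 hev
  have hδ0 : 0 < δ := hδ
  have hsmall : ∀ r : ℝ≥0, 0 < r → r ≤ δ → (c : ℝ) * (r : ℝ) ^ γ ≤ ω r := by
    intro r hr hrδ
    have h1 : (c : ℝ≥0∞) < (ω r : ℝ≥0∞) / (r : ℝ≥0∞) ^ γ := hδω ⟨hr, hrδ⟩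
    have h2 := (ENNReal.mul_lt_of_lt_div h1).le
    rw [← ENNReal.coe_rpow_of_nonneg _ hγ.le, ← ENNReal.coe_mul, ENNReal.coe_le_coe] at h2
    exact_mod_cast h2
  have hωδ : 0 < (ω δ : ℝ) :=
    lt_of_lt_of_le (mul_pos (by exact_mod_cast hc0')
      (Real.rpow_pos_of_pos (by exact_mod_cast hδ0) _))
      (hsmall δ hδ0 le_rfl)
  have hc0r : (0 : ℝ) < c := by exact_mod_cast hc0'
  refine ⟨(c : ℝ)⁻¹ + (T : ℝ) ^ γ / ω δ, by positivity, fun r hr hrT => ?_⟩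
  rcases le_total r δ with h | h
  · have h1 := hsmall r hr h
    have h2 : (0 : ℝ) < (r : ℝ) ^ γ := Real.rpow_pos_of_pos (by exact_mod_cast hr) _
    have h3 : (0 : ℝ) < ω r := lt_of_lt_of_le (by positivity) h1
    refine ⟨by exact_mod_cast h3, ?_⟩
    have h4 : (r : ℝ) ^ γ ≤ (c : ℝ)⁻¹ * ω r := by
      rw [← div_eq_inv_mul, le_div_iff₀ hc0r]
      linarith
    have h5 : 0 ≤ (T : ℝ) ^ γ / ω δ * ω r := by positivity
    linarith
  · have h1 : (ω δ : ℝ) ≤ ω r := by exact_mod_cast hω.monotone h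
    refine ⟨by exact_mod_cast hωδ.trans_le h1, ?_⟩
    have h2 : (r : ℝ) ^ γ ≤ (T : ℝ) ^ γ := by
      have : (r : ℝ) ≤ T := by exact_mod_cast hrT
      gcongr
    have h3 : (T : ℝ) ^ γ ≤ (T : ℝ) ^ γ / ω δ * ω r := by
      rw [div_mul_eq_mul_div, le_div_iff₀ hωδ]
      gcongr
    have h5 : 0 ≤ (c : ℝ)⁻¹ * ω r := by positivity
    linarith

end Curves

/-! ### Continuity and `C^{0,ω}` regularity of the flow map. -/

section FlowMap

variable {k d : ℕ} {β : ℝ}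

/-- A map that assigns to each vector field its flow is continuous. -/
theorem continuous_flow (hβ : β ∈ Ioc (0 : ℝ) 1)
    {flow : L1Minus (k + 1) β d → C(I, DiffMinus (k + 1) β d)}
    (hflow : ∀ u : strongFields (k + 1) β d, IsPointwiseFlow u.1 fun t => flow (L1Minus.mk u) t) :
    Continuous flow := by
  -- Joint continuity in field and time suffices. It combines the estimate in the field, uniform in
  -- time, with continuity in time for the fixed field `q₀`.
  refine ContinuousMap.continuous_of_continuous_uncurry _ (continuous_diffMinus_iff.2 fun α => ?_)
  obtain ⟨α', hα'⟩ := exists_norm_flow_sub_le (k := k) (d := d) hβ α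
  refine continuous_iff_continuousAt.2 fun ⟨q₀, t₀⟩ => Metric.tendsto_nhds.2 fun η hη => ?_
  obtain ⟨C, γ, hC, hγ, h⟩ := hα' (‖L1Minus.toL1 α' q₀‖ + 1) 1 (by positivity) one_pos
  obtain ⟨ε, ⟨hε0, hε1⟩, hε⟩ := exists_mul_rpow_lt C hγ (half_pos hη)
  have hq : ∀ᶠ q in 𝓝 q₀, dist (L1Minus.toL1 α' q) (L1Minus.toL1 α' q₀) < ε :=
    Metric.tendsto_nhds.1 ((L1Minus.continuous_toL1 α').tendsto q₀) ε hε0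
  have ht : ∀ᶠ t in 𝓝 t₀, dist (C0HolderMinus.incl α (flow q₀ t).chart)
      (C0HolderMinus.incl α (flow q₀ t₀).chart) < η / 2 :=
    Metric.tendsto_nhds.1
      ((continuous_diffMinus_iff.1 (flow q₀).continuous α).tendsto t₀) _ (half_pos hη)
  rw [nhds_prod_eq]
  filter_upwards [hq.prod_mk ht] with ⟨q, t⟩ ⟨h1, h2⟩
  obtain ⟨u, rfl⟩ := L1Minus.mk_surjective q
  obtain ⟨u₀, rfl⟩ := L1Minus.mk_surjective q₀
  rw [dist_eq_norm] at h1
  have h3 := h u u₀ (flow (L1Minus.mk u)) (flow (L1Minus.mk u₀)) (hflow u) (hflow u₀) (by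
    have := norm_le_norm_add_norm_sub' (L1Minus.toL1 α' (L1Minus.mk u))
      (L1Minus.toL1 α' (L1Minus.mk u₀))
    exact this.trans (add_le_add le_rfl (h1.le.trans hε1)))
    (le_add_of_nonneg_right zero_le_one) ε hε0 hε1 h1.le t
  rw [← dist_eq_norm] at h3
  exact (dist_triangle _ _ _).trans_lt (by
    have := add_lt_add_of_le_of_lt (h3.trans hε.le) h2
    rwa [add_halves] at this)

/-- A map that assigns to each vector field its flow is `C^{0,ω}`. -/
theorem isC0OmegaMap_flow (hβ : β ∈ Ioc (0 : ℝ) 1)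
    {flow : L1Minus (k + 1) β d → C(I, DiffMinus (k + 1) β d)}
    (hflow : ∀ u : strongFields (k + 1) β d, IsPointwiseFlow u.1 fun t => flow (L1Minus.mk u) t)
    {ω : ℝ≥0 → ℝ≥0} (hω : IsSlowlyVanishing ω) :
    IsC0OmegaMap ω fun v => DiffMinus.chartMap.comp (flow v) := by
  intro c hc a b
  refine isVonNBounded_of_forall_norm_le fun α => ?_
  obtain ⟨α', hα'⟩ := exists_norm_flow_sub_le (k := k) (d := d) hβ α
  obtain ⟨R, L, hR, hL, hcR, hcL⟩ := hc.exists_lipschitz α' a b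
  set T : ℝ≥0 := Real.toNNReal (b - a) with hT
  -- `T + 1` rather than `T`, so that the upper bound for `L * r` is positive even when `T = 0`.
  obtain ⟨C, γ, hC, hγ, h⟩ := hα' R (L * (T + 1)) hR (by positivity)
  obtain ⟨A, hA, hAω⟩ := hω.exists_rpow_le hγ T
  refine ⟨C * L ^ γ * A, ?_⟩
  rintro w ⟨s, hs, t, ht, hts, rfl⟩ τ
  set r : ℝ≥0 := nndist t s with hr
  have hr0 : 0 < r := by
    rw [← NNReal.coe_pos, coe_nndist]
    exact dist_pos.2 hts
  have hr' : (r : ℝ) = |t - s| := by rw [hr, coe_nndist, Real.dist_eq]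
  have hrT : r ≤ T := by
    rw [← NNReal.coe_le_coe, hr', hT]
    refine le_trans ?_ (Real.le_coe_toNNReal _)
    rw [abs_le]
    constructor <;> linarith [hs.1, hs.2, ht.1, ht.2]
  obtain ⟨hω0, hωr⟩ := hAω r hr0 hrT
  have hω0' : (0 : ℝ) < ω r := by exact_mod_cast hω0
  obtain ⟨u, hu⟩ := L1Minus.mk_surjective (c t)
  obtain ⟨v, hv⟩ := L1Minus.mk_surjective (c s)
  have hr0' : (0 : ℝ) < r := by exact_mod_cast hr0
  have hrT' : (r : ℝ) ≤ T := by exact_mod_cast hrT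
  have h1 := h u v (flow (L1Minus.mk u)) (flow (L1Minus.mk v)) (hflow u) (hflow v)
    (by rw [hu]; exact hcR t ht) (by rw [hv]; exact hcR s hs) (L * r) (by positivity)
    (by gcongr; linarith) (by rw [hu, hv, hr']; exact hcL s hs t ht) τ
  rw [hu, hv] at h1
  change ‖C0HolderMinus.incl α (((ω r : ℝ≥0) : ℝ)⁻¹ •
    ((flow (c t) τ).chart - (flow (c s) τ).chart))‖ ≤ _
  rw [map_smul, map_sub, norm_smul, norm_inv, Real.norm_of_nonneg hω0'.le, inv_mul_le_iff₀ hω0']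
  calc _ ≤ C * (L * r) ^ γ := h1
    _ = C * L ^ γ * (r : ℝ) ^ γ := by rw [Real.mul_rpow hL.le hr0'.le, mul_assoc]
    _ ≤ C * L ^ γ * (A * ω r) := by gcongr
    _ = _ := by ring

end FlowMap

end HolderFlow

theorem mainTheorem12 (d n : ℕ) (hn : 2 ≤ n) (β : ℝ) (hβ : β ∈ Set.Ioc (0 : ℝ) 1) :
    ∃ flow : HolderFlow.L1Minus n β d → C(unitInterval, HolderFlow.DiffMinus n β d),
      (∀ u : HolderFlow.strongFields n β d,
        HolderFlow.IsPointwiseFlow u.1 (fun t => flow (HolderFlow.L1Minus.mk u) t) ∧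
        ∀ Ψ : unitInterval → HolderFlow.Space d → HolderFlow.Space d,
          HolderFlow.IsPointwiseFlow u.1 Ψ →
            ∀ t x, Ψ t x = flow (HolderFlow.L1Minus.mk u) t x) ∧
      Continuous flow ∧
      ∀ ω : NNReal → NNReal, HolderFlow.IsSlowlyVanishing ω →
        HolderFlow.IsC0OmegaMap ω
          (fun v : HolderFlow.L1Minus n β d => HolderFlow.DiffMinus.chartMap.comp (flow v)) := by
  obtain ⟨k, rfl⟩ : ∃ k, n = k + 1 := ⟨n - 1, by omega⟩
  -- The chosen `φ` serves all representatives of the class at once, since changing the field on a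
  -- null set does not change the integral equation.
  have hex : ∀ q : HolderFlow.L1Minus (k + 1) β d,
      ∃ φ : C(unitInterval, HolderFlow.DiffMinus (k + 1) β d),
        ∀ u, HolderFlow.L1Minus.mk u = q → HolderFlow.IsPointwiseFlow u.1 fun t => φ t := by
    intro q
    obtain ⟨v, rfl⟩ := HolderFlow.L1Minus.mk_surjective q
    obtain ⟨φ, hφ⟩ := HolderFlow.exists_pointwiseFlow hβ v
    refine ⟨φ, fun u hu => hφ.congr ?_⟩
    have h1 : u - v ∈ HolderFlow.nullFields (k + 1) β d := (Submodule.Quotient.eq _).1 hu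
    have h2 : ∀ᵐ t ∂(volume : Measure unitInterval), u.1 t - v.1 t = 0 := h1
    filter_upwards [h2] with t ht
    exact (sub_eq_zero.1 ht).symm
  choose flow hflow' using hex
  have hflow : ∀ u : HolderFlow.strongFields (k + 1) β d,
      HolderFlow.IsPointwiseFlow u.1 fun t => flow (HolderFlow.L1Minus.mk u) t := fun u =>
    hflow' _ u rfl
  refine ⟨flow, fun u => ⟨hflow u, fun Ψ hΨ t x => ?_⟩, HolderFlow.continuous_flow hβ hflow,
    fun ω hω => HolderFlow.isC0OmegaMap_flow hβ hflow hω⟩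
  let α : Set.Ioo (0 : ℝ) β := ⟨β / 2, half_pos hβ.1, half_lt_self hβ.1⟩
  exact HolderFlow.IsFlow.eq_of_isFlow (HolderFlow.mem_Ioc_of_mem_Ioo hβ α) (u.2 α)
    (HolderFlow.IsPointwiseFlow.isFlow hΨ α) ((hflow u).isFlow α) t x
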